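/- Let $d\ge 1$ and $\beta>0$, write $\phi_\beta(x)=e^{\beta x}/(1+e^{\beta x})$, and let $\mathcal O\subseteq\mathcal A$, where $\mathcal A$ is a subset of the closed Euclidean unit ball of $\mathbb R^d$ and $\mathcal O$ a subset of the unit sphere of $\mathbb R^d$. In the logistic bandit problem an unknown parameter $\Theta$ is drawn from a prior distribution concentrated on $\mathcal O$, and playing the action $a\in\mathcal A$ when $\Theta=\theta$ yields a reward $R(a,\theta)\in\{0,1\}$ which, given the past, is a Bernoulli variable with $\mathbb P(R(a,\theta)=1)=\phi_\beta(\langle a,\theta\rangle)$. Let $\pi^\star(\theta)\in\operatorname{argmax}_{a\in\mathcal A}\mathbb E[R(a,\theta)]$ for $\theta\in\mathcal O$ be a measurable optimal mapping and $A^\star=\pi^\star(\Theta)$. Thompson Sampling, run for $T$ steps, samples at each time $t\in\{1,\dots,T\}$ a parameter $\hat\Theta_t$ from the posterior distribution of $\Theta$ given the history $H^t=(A_1,R_1,\dots,A_{t-1},R_{t-1})$, independently of $\Theta$ given $H^t$, plays $A_t=\pi^\star(\hat\Theta_t)$ and collects $R_t=R(A_t,\Theta)$. Its information ratio at time $t$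 is the random variable $$\Gamma_t=\frac{\mathbb E\big[R(A^\star,\Theta)-R(A_t,\Theta)\,\big|\,H^t\big]^2}{I_t\big(A^\star;\,(R(A_t,\Theta),A_t)\big)},$$ where $I_t(X;Y)$ denotes the mutual information (in nats) of $X$ and $Y$ under their joint conditional law given $H^t$, that is, the Kullback–Leibler divergence of the conditional joint law from the product of the conditional marginals; the ratio is read as $0$ if numerator and denominator both vanish and as $+\infty$ if only the denominator vanishes. Then, for every such $\beta$, $\mathcal A$, $\mathcal O$, every such prior and every $t\in\{1,\dots,T\}$, $$\Gamma_t\le\frac92\,d\qquad\text{almost surely.}$$ -/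

import Mathlib

open MeasureTheory ProbabilityTheory InformationTheory
open scoped ENNReal

noncomputable section

namespace LogisticBandit

/-- Euclidean space `ℝᵈ`, in which actions and parameters live. -/
abbrev Vec (d : ℕ) : Type := EuclideanSpace ℝ (Fin d)

/-- The logistic link function `φ_β(x) = e^{βx} / (1 + e^{βx})`. -/
def logistic (β x : ℝ) : ℝ := Real.exp (β * x) / (1 + Real.exp (β * x))

theorem logistic_mem_unitInterval (β x : ℝ) : logistic β x ∈ unitInterval := by
  have h := Real.exp_pos (β * x)
  refine ⟨by unfold logistic; positivity, ?_⟩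
  unfold logistic
  rw [div_le_one (by positivity)]
  linarith

/-- The law of the binary reward `R(a, θ) ∈ {0, 1}`: it is `1` with probability
`φ_β(⟨a, θ⟩)` and `0` otherwise. -/
def rewardLaw {d : ℕ} (β : ℝ) (a θ : Vec d) : Measure ℝ :=
  bernoulliMeasure (1 : ℝ) 0 ⟨logistic β (inner ℝ a θ), logistic_mem_unitInterval β _⟩

/-- The expected reward `E[R(a, θ)]`. -/
def meanReward {d : ℕ} (β : ℝ) (a θ : Vec d) : ℝ := ∫ r, r ∂(rewardLaw β a θ)

/-- `π` is an optimal mapping `π⋆(θ) ∈ argmax_{a ∈ 𝒜} E[R(a, θ)]` for the parameters `θ ∈ 𝒪`. -/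
def IsOptimalMap {d : ℕ} (β : ℝ) (𝒜 𝒪 : Set (Vec d)) (π : Vec d → Vec d) : Prop :=
  ∀ θ ∈ 𝒪, π θ ∈ 𝒜 ∧ IsMaxOn (fun a => meanReward β a θ) 𝒜 (π θ)

section Runs

variable {d : ℕ} {Ω : Type*} [MeasurableSpace Ω]

/-- The history `Hᵗ` of the actions `A_s = π(Θ̂_s)` and the rewards `R_s`, `s < t`
(time steps are numbered `0, 1, …, T - 1`). -/
def history (π : Vec d → Vec d) (Θhat : ℕ → Ω → Vec d) (R : ℕ → Ω → ℝ) (t : ℕ) (ω : Ω) :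
    Fin t → Vec d × ℝ :=
  fun s => (π (Θhat s ω), R s ω)

/-- A run of length `T` of Thompson sampling on the logistic bandit with scale `β`, prior `prior`
and optimal mapping `π`, realised on the probability space `(Ω, μ)`:
* `Θ` is the unknown parameter;
* `Θhat t` is the parameter sampled at time `t`, and `A_t = π (Θhat t)` is the action taken;
* `R t` is the reward `R(A_t, Θ)` collected at time `t`;
* `Ropt t` is the reward `R(A⋆, Θ)` which the optimal action `A⋆ = π(Θ)` would give at time `t`.
-/
structure IsThompsonRun (β : ℝ) (T : ℕ) (prior : Measure (Vec d)) (π : Vec d → Vec d)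
    (Θ : Ω → Vec d) (Θhat : ℕ → Ω → Vec d) (R Ropt : ℕ → Ω → ℝ)
    (μ : Measure Ω) [IsProbabilityMeasure μ] : Prop where
  measurable_param : Measurable Θ
  measurable_sample : ∀ t, Measurable (Θhat t)
  measurable_reward : ∀ t, Measurable (R t)
  measurable_optReward : ∀ t, Measurable (Ropt t)
  /-- The parameter is drawn from the prior. -/
  law_param : μ.map Θ = prior
  /-- Given the history (and `Θ`), the sample `Θhat t` is drawn from the posterior law of `Θ`
  given the history; in particular it is independent of `Θ` given the history. -/
  law_sample : ∀ t < T, ∀ᵐ ω ∂μ,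
    condDistrib (Θhat t) (fun ω' => (history π Θhat R t ω', Θ ω')) μ (history π Θhat R t ω, Θ ω)
      = condDistrib Θ (history π Θhat R t) μ (history π Θhat R t ω)
  /-- Given the history, `Θ` and `Θhat t`, the reward has the law of `R(A_t, Θ)`. -/
  law_reward : ∀ t < T, ∀ᵐ ω ∂μ,
    condDistrib (R t) (fun ω' => (history π Θhat R t ω', Θ ω', Θhat t ω')) μ
        (history π Θhat R t ω, Θ ω, Θhat t ω)
      = rewardLaw β (π (Θhat t ω)) (Θ ω)
  /-- Given the history and `Θ`, the optimal reward has the law of `R(A⋆, Θ)`. -/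
  law_optReward : ∀ t < T, ∀ᵐ ω ∂μ,
    condDistrib (Ropt t) (fun ω' => (history π Θhat R t ω', Θ ω')) μ (history π Θhat R t ω, Θ ω)
      = rewardLaw β (π (Θ ω)) (Θ ω)

/-- The disintegrated mutual information (in nats) of `X` and `Y` given `Z`: the random variable
`D_KL(P_{(X,Y)|Z} ‖ P_{X|Z} ⊗ P_{Y|Z})`. -/
def disintegratedMutualInfo {𝒳 𝒴 𝒵 : Type*}
    [MeasurableSpace 𝒳] [StandardBorelSpace 𝒳] [Nonempty 𝒳]
    [MeasurableSpace 𝒴] [StandardBorelSpace 𝒴] [Nonempty 𝒴] [MeasurableSpace 𝒵]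
    (X : Ω → 𝒳) (Y : Ω → 𝒴) (Z : Ω → 𝒵) (μ : Measure Ω) [IsProbabilityMeasure μ] (ω : Ω) : ℝ≥0∞ :=
  klDiv (condDistrib (fun ω' => (X ω', Y ω')) Z μ (Z ω))
    ((condDistrib X Z μ (Z ω)).prod (condDistrib Y Z μ (Z ω)))

/-- The expected regret at time `t` given the history, `E_t[R(A⋆, Θ) - R(A_t, Θ)]`. -/
def condRegret (π : Vec d → Vec d) (Θhat : ℕ → Ω → Vec d) (R Ropt : ℕ → Ω → ℝ)
    (μ : Measure Ω) (t : ℕ) : Ω → ℝ :=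
  μ[fun ω => Ropt t ω - R t ω |
    MeasurableSpace.comap (history π Θhat R t) inferInstance]

/-- The information ratio
`Γ_t = E_t[R(A⋆, Θ) - R(A_t, Θ)]² / I_t(A⋆; (R(A_t, Θ), A_t))`, with values in `[0, ∞]`; here
`x / 0 = ∞` for `x > 0`, and `0 / 0 = 0`. -/
def infoRatio (π : Vec d → Vec d) (Θ : Ω → Vec d) (Θhat : ℕ → Ω → Vec d) (R Ropt : ℕ → Ω → ℝ)
    (μ : Measure Ω) [IsProbabilityMeasure μ] (t : ℕ) (ω : Ω) : ℝ≥0∞ :=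
  ENNReal.ofReal (condRegret π Θhat R Ropt μ t ω ^ 2) /
    disintegratedMutualInfo (fun ω' => π (Θ ω')) (fun ω' => (R t ω', π (Θhat t ω')))
      (history π Θhat R t) μ ω

end Runs

end LogisticBandit

end

/-!
A parameter of the unit sphere is its own optimal action, so `A⋆ = Θ` and `A_t = Θhat t`: given the
history, the action `a` and the parameter `θ` are independent with the posterior law `ν`. Write
`f = φ_β`, `x = ⟪a, θ⟫` and `f̄(a) = E_θ f(x)`. The conditional regret is `f(1) - E f̄(a)`, and the
mutual information is at least `2 E (f(x) - f̄(a))²` by a variational bound for the divergence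
(`two_mul_integral_variance_le_klDiv`), with a test function taken from Hoeffding's lemma. It remains
to bound the square of the regret by `9 d E (f(x) - f̄(a))²`; `sq_regret_le` does so with `6 d`.

After an affine change of scale, `f` becomes an odd increasing link `η`, concave on `[0, 1]`, with
`η(1) = 1`; let `m(a) = E_θ η(x)`. The tool is a trace inequality
(`sq_integral_inner_le_card_mul`): a kernel of rank `n` satisfies `(tr K)² ≤ n ‖K‖²` in the
Hilbert–Schmidt norm. The actions are split by the sign of `m`.

* If `m(a) ≥ 0`, then `m(a) = η(x₀)` with `x₀ ∈ [0, 1]`, and concavity and oddness give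
  `|η(x) - m(a)| ≥ λ |x - x₀|` on `[-1, 1]`, where `λ = (1 - m(a)) / (1 - x₀)` is the slope of the
  chord. The kernel `λ(a) (⟪a, θ⟫ - x₀(a))` has rank at most `d + 1`, and its trace is the regret
  of these actions (`sq_regret_nonneg_part_le`).
* If `m(a) = -y < 0`, the slope of such a chord can be far too small. Instead, for two such actions
  `a` and `θ`, the quantity `(1 + y)(1 + y') x²` is at most twice the sum of the squared deviations
  of `η(x)` from `-y` and `-y'`, minus a multiple of `√y √y' x`; the latter is a positive
  semidefinite kernel and so has a nonnegative mean. The trace inequality for the kernel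
  `√(1 + y) √(1 + y') x` of rank `d` then bounds the regret (`sq_regret_neg_part_le`).
-/

open MeasureTheory ProbabilityTheory InformationTheory
open scoped ENNReal

noncomputable section

namespace LogisticBandit

/-! ### A trace inequality for kernels of finite rank -/

section Trace

variable {α : Type*} [MeasurableSpace α]

theorem integrable_of_measurable_bounded {ν : Measure α} [IsFiniteMeasure ν] {f : α → ℝ}
    (hf : Measurable f) {C : ℝ} (hC : ∀ a, |f a| ≤ C) : Integrable f ν :=
  Integrable.of_bound hf.aestronglyMeasurable C (.of_forall hC)

/-- The Cauchy–Schwarz inequality for integrals. -/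
theorem sq_integral_mul_le {ν : Measure α} {f g : α → ℝ}
    (hff : Integrable (fun a => f a ^ 2) ν) (hgg : Integrable (fun a => g a ^ 2) ν)
    (hfg : Integrable (fun a => f a * g a) ν) :
    (∫ a, f a * g a ∂ν) ^ 2 ≤ (∫ a, f a ^ 2 ∂ν) * ∫ a, g a ^ 2 ∂ν := by
  have h : ∀ t : ℝ, 0 ≤ (∫ a, g a ^ 2 ∂ν) * (t * t) + (-2 * ∫ a, f a * g a ∂ν) * t
      + ∫ a, f a ^ 2 ∂ν := by
    intro t
    have h0 : 0 ≤ ∫ a, (f a - t * g a) ^ 2 ∂ν := integral_nonneg fun a => sq_nonneg _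
    have h1 : ∫ a, (f a - t * g a) ^ 2 ∂ν
        = ∫ a, (f a ^ 2 - 2 * t * (f a * g a) + t ^ 2 * g a ^ 2) ∂ν := by
      congr 1; ext a; ring
    have h2 : Integrable (fun a => 2 * t * (f a * g a)) ν := hfg.const_mul _
    have h3 : Integrable (fun a => f a ^ 2 - 2 * t * (f a * g a)) ν := hff.sub h2
    rw [h1, integral_add h3 (hgg.const_mul _), integral_sub hff h2, integral_const_mul,
      integral_const_mul] at h0
    linarith
  have := discrim_le_zero h
  unfold discrim at this
  linarith

variable {ι : Type*} [Fintype ι] [DecidableEq ι]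

/-- A bound of the trace by the Hilbert–Schmidt norm: a kernel `⟪b a, ψ θ⟫` which factors through
`ℝⁿ` has rank at most `n`, so the square of its trace is at most `n` times the square of its
Hilbert–Schmidt norm. -/
theorem sq_integral_inner_le_card_mul {ν : Measure α} [IsFiniteMeasure ν]
    {b ψ : α → EuclideanSpace ℝ ι} (hb : Measurable b) (hψ : Measurable ψ) {C : ℝ}
    (hbC : ∀ a, ‖b a‖ ≤ C) (hψC : ∀ a, ‖ψ a‖ ≤ C) :
    (∫ a, inner ℝ (b a) (ψ a) ∂ν) ^ 2
      ≤ Fintype.card ι * ∫ a, ∫ θ, inner ℝ (b a) (ψ θ) ^ 2 ∂ν ∂ν := by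
  -- the second moment matrix of `ψ`, whose eigenbasis diagonalises the kernel
  let M : Matrix ι ι ℝ := fun i j => ∫ θ, ψ θ i * ψ θ j ∂ν
  have hM : M.IsHermitian := by
    ext i j
    rw [Matrix.conjTranspose_apply, star_trivial]
    simp only [M, mul_comm]
  let v := hM.eigenvectorBasis
  have hCnn : ∀ a : α, 0 ≤ C := fun a => (norm_nonneg _).trans (hbC a)
  have hint : ∀ {u w : α → EuclideanSpace ℝ ι}, Measurable u → Measurable w →
      (∀ a, ‖u a‖ ≤ C) → (∀ a, ‖w a‖ ≤ C) → ∀ x y : EuclideanSpace ℝ ι,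
      Integrable (fun a => inner ℝ x (u a) * inner ℝ y (w a)) ν := by
    intro u w hu hw huC hwC x y
    refine integrable_of_measurable_bounded (C := ‖x‖ * C * (‖y‖ * C)) (by fun_prop) fun a => ?_
    have := hCnn a
    rw [abs_mul]
    gcongr
    · exact (abs_real_inner_le_norm _ _).trans (by gcongr; exact huC a)
    · exact (abs_real_inner_le_norm _ _).trans (by gcongr; exact hwC a)
  -- the coordinates of `ψ` in the eigenbasis are uncorrelated
  have horth : ∀ k l, ∫ θ, inner ℝ (v k) (ψ θ) * inner ℝ (v l) (ψ θ) ∂ν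
      = if k = l then hM.eigenvalues k else 0 := by
    intro k l
    have hcoord : ∀ i j, Integrable (fun θ => v k i * v l j * (ψ θ i * ψ θ j)) ν := by
      intro i j
      have := (hint hψ hψ hψC hψC (EuclideanSpace.single i 1) (EuclideanSpace.single j 1)).const_mul
        (v k i * v l j)
      simpa [EuclideanSpace.inner_single_left] using this
    have h1 : ∫ θ, inner ℝ (v k) (ψ θ) * inner ℝ (v l) (ψ θ) ∂ν
        = ∑ i, ∑ j, v k i * v l j * M i j := by
      have : ∀ θ, inner ℝ (v k) (ψ θ) * inner ℝ (v l) (ψ θ)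
          = ∑ i, ∑ j, v k i * v l j * (ψ θ i * ψ θ j) := by
        intro θ
        simp only [PiLp.inner_apply, RCLike.inner_apply, conj_trivial, Finset.sum_mul_sum]
        refine Finset.sum_congr rfl fun i _ => Finset.sum_congr rfl fun j _ => by ring
      simp_rw [this]
      rw [integral_finsetSum _ fun i _ => integrable_finsetSum _ fun j _ => hcoord i j]
      refine Finset.sum_congr rfl fun i _ => ?_
      rw [integral_finsetSum _ fun j _ => hcoord i j]
      refine Finset.sum_congr rfl fun j _ => ?_
      rw [integral_const_mul]
    have h2 : ∑ i, ∑ j, v k i * v l j * M i j = hM.eigenvalues l * inner ℝ (v k) (v l) := by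
      have h3 : ∀ i, ∑ j, M i j * v l j = hM.eigenvalues l * v l i := by
        intro i
        have := congrFun (hM.mulVec_eigenvectorBasis l) i
        simpa [Matrix.mulVec, dotProduct] using this
      simp only [PiLp.inner_apply, RCLike.inner_apply, conj_trivial, Finset.mul_sum]
      refine Finset.sum_congr rfl fun i _ => ?_
      have : ∑ j, v k i * v l j * M i j = v k i * ∑ j, M i j * v l j := by
        rw [Finset.mul_sum]
        exact Finset.sum_congr rfl fun j _ => by ring
      rw [this, h3]; ring
    rw [h1, h2, orthonormal_iff_ite.1 v.orthonormal k l]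
    split_ifs with h
    · rw [h, mul_one]
    · rw [mul_zero]
  have hexp : ∀ a θ, inner ℝ (b a) (ψ θ) = ∑ k, inner ℝ (v k) (b a) * inner ℝ (v k) (ψ θ) := by
    intro a θ
    rw [← v.sum_inner_mul_inner]
    exact Finset.sum_congr rfl fun k _ => by rw [real_inner_comm]
  have hR : ∫ a, ∫ θ, inner ℝ (b a) (ψ θ) ^ 2 ∂ν ∂ν
      = ∑ k, (∫ a, inner ℝ (v k) (b a) ^ 2 ∂ν) * ∫ θ, inner ℝ (v k) (ψ θ) ^ 2 ∂ν := by
    have h1 : ∀ a, ∫ θ, inner ℝ (b a) (ψ θ) ^ 2 ∂ν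
        = ∑ k, inner ℝ (v k) (b a) ^ 2 * hM.eigenvalues k := by
      intro a
      have : ∀ θ, inner ℝ (b a) (ψ θ) ^ 2 = ∑ k, ∑ l,
          inner ℝ (v k) (b a) * inner ℝ (v l) (b a) *
            (inner ℝ (v k) (ψ θ) * inner ℝ (v l) (ψ θ)) := by
        intro θ
        rw [hexp, sq, Finset.sum_mul_sum]
        refine Finset.sum_congr rfl fun i _ => Finset.sum_congr rfl fun j _ => by ring
      simp_rw [this]
      have hi := fun k l => (hint hψ hψ hψC hψC (v k) (v l)).const_mul
        (inner ℝ (v k) (b a) * inner ℝ (v l) (b a))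
      rw [integral_finsetSum _ fun i _ => integrable_finsetSum _ fun j _ => hi i j]
      refine Finset.sum_congr rfl fun k _ => ?_
      rw [integral_finsetSum _ fun j _ => hi k j]
      simp_rw [integral_const_mul, horth]
      simp [sq]
    simp_rw [h1]
    rw [integral_finsetSum]
    · refine Finset.sum_congr rfl fun k _ => ?_
      rw [integral_mul_const]
      congr 1
      have := horth k k
      simp only [if_true] at this
      rw [← this]
      simp [sq]
    · intro k _
      refine Integrable.mul_const ?_ _
      simpa [sq] using hint hb hb hbC hbC (v k) (v k)
  rw [hR]
  have hL : ∫ a, inner ℝ (b a) (ψ a) ∂ν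
      = ∑ k, ∫ a, inner ℝ (v k) (b a) * inner ℝ (v k) (ψ a) ∂ν := by
    simp_rw [hexp]
    exact integral_finsetSum _ fun k _ => hint hb hψ hbC hψC _ _
  rw [hL]
  refine sq_sum_le_card_mul_sum_sq.trans ?_
  rw [Finset.card_univ]
  gcongr with k
  refine sq_integral_mul_le ?_ ?_ (hint hb hψ hbC hψC _ _)
  · simpa [sq] using hint hb hb hbC hbC (v k) (v k)
  · simpa [sq] using hint hψ hψ hψC hψC (v k) (v k)

end Trace

/-! ### Odd links and the logistic function -/

/-- A link function on `[-1, 1]`, centred and scaled to be odd with value `1` at `1`: it is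
increasing, and concave on `[0, 1]`. -/
structure IsOddLink (η : ℝ → ℝ) : Prop where
  monotone : Monotone η
  odd : ∀ x, η (-x) = -η x
  concaveOn : ConcaveOn ℝ (Set.Icc 0 1) η
  map_one : η 1 = 1

namespace IsOddLink

variable {η : ℝ → ℝ} (h : IsOddLink η)

include h

theorem map_zero : η 0 = 0 := by
  have := h.odd 0
  rw [neg_zero] at this
  linarith

theorem abs_le_one {x : ℝ} (hx : |x| ≤ 1) : |η x| ≤ 1 := by
  rw [abs_le] at hx ⊢
  have h1 := h.monotone hx.1
  have h2 := h.monotone hx.2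
  rw [h.odd, h.map_one] at h1
  rw [h.map_one] at h2
  exact ⟨h1, h2⟩

theorem combo_le {x y a b : ℝ} (hx : x ∈ Set.Icc (0 : ℝ) 1) (hy : y ∈ Set.Icc (0 : ℝ) 1)
    (ha : 0 ≤ a) (hb : 0 ≤ b) (hab : a + b = 1) : a * η x + b * η y ≤ η (a * x + b * y) :=
  h.concaveOn.2 hx hy ha hb hab

theorem le_apply {x : ℝ} (h0 : 0 ≤ x) (h1 : x ≤ 1) : x ≤ η x := by
  have := h.combo_le (x := 0) (y := 1) (by simp) (by simp) (a := 1 - x) (b := x)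
    (by linarith) h0 (by ring)
  simpa [h.map_zero, h.map_one] using this

/-- The chord of an odd link between `x₀ ≥ 0` and `1` lies closer to the value at `x₀` than the
link itself, on all of `[-1, 1]`. -/
theorem chord_mul_abs_le {x₀ x : ℝ} (h0 : 0 ≤ x₀) (h1 : x₀ < 1) (hx : |x| ≤ 1) :
    (1 - η x₀) / (1 - x₀) * |x - x₀| ≤ |η x - η x₀| := by
  rw [abs_le] at hx
  have hpos : 0 < 1 - x₀ := by linarith
  have hη : x₀ ≤ η x₀ := h.le_apply h0 h1.le
  have hη1 : η x₀ ≤ 1 := h.map_one ▸ h.monotone h1.le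
  rw [div_mul_eq_mul_div, div_le_iff₀ hpos]
  rcases lt_trichotomy x x₀ with hlt | rfl | hgt
  · rw [abs_of_neg (by linarith), abs_of_nonpos (by linarith [h.monotone hlt.le])]
    rcases le_total 0 x with hx0 | hx0
    · -- concavity at `x ≤ x₀ < 1`
      have := h.combo_le (x := x) (y := 1) ⟨hx0, hx.2⟩ (by simp) (a := (1 - x₀) / (1 - x))
        (b := (x₀ - x) / (1 - x)) (div_nonneg hpos.le (by linarith))
        (div_nonneg (by linarith) (by linarith)) (by
          rw [← add_div, div_eq_one_iff_eq (by linarith)]; ring)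
      have e : (1 - x₀) / (1 - x) * x + (x₀ - x) / (1 - x) * 1 = x₀ := by
        field_simp [show (1 - x) ≠ 0 by linarith]
        ring
      rw [e, h.map_one] at this
      have h2 : 0 < 1 - x := by linarith
      rw [div_mul_eq_mul_div, div_mul_eq_mul_div, ← add_div, div_le_iff₀ h2] at this
      nlinarith
    · -- on the negative side the link lies below the diagonal
      have h2 := h.le_apply (x := -x) (by linarith) (by linarith)
      rw [h.odd] at h2
      nlinarith
  · simp
  · rw [abs_of_pos (by linarith), abs_of_nonneg (by linarith [h.monotone hgt.le])]
    -- concavity at `x₀ < x ≤ 1`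
    have := h.combo_le (x := x₀) (y := 1) ⟨h0, h1.le⟩ (by simp) (a := (1 - x) / (1 - x₀))
      (b := (x - x₀) / (1 - x₀)) (div_nonneg (by linarith) hpos.le)
      (div_nonneg (by linarith) hpos.le) (by
        rw [← add_div, div_eq_one_iff_eq (by linarith)]; ring)
    have e : (1 - x) / (1 - x₀) * x₀ + (x - x₀) / (1 - x₀) * 1 = x := by
      field_simp
      ring
    rw [e, h.map_one, div_mul_eq_mul_div, div_mul_eq_mul_div, ← add_div, div_le_iff₀ hpos] at this
    nlinarith

/-- The pointwise inequality behind the bound for actions of negative mean reward: here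
`-y₁, -y₂ ≤ 0` are the mean rewards of two such actions, and `x` is their inner product. -/
theorem two_mul_sq_add_le {x y₁ y₂ : ℝ} (hx : |x| ≤ 1) (hy₁ : 0 ≤ y₁) (hy₁' : y₁ ≤ 1)
    (hy₂ : 0 ≤ y₂) (hy₂' : y₂ ≤ 1) :
    2 * ((1 + y₁) * (1 + y₂)) * x ^ 2 + 16 * (√y₁ * √y₂) * x
      ≤ 4 * ((η x + y₁) ^ 2 + (η x + y₂) ^ 2) := by
  rw [abs_le] at hx
  have hs₁ := Real.sq_sqrt hy₁
  have hs₂ := Real.sq_sqrt hy₂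
  have hn₁ := Real.sqrt_nonneg y₁
  have hn₂ := Real.sqrt_nonneg y₂
  set s₁ := √y₁
  set s₂ := √y₂
  rcases le_total 0 x with h0 | h0
  · have hη := h.le_apply h0 hx.2
    have h1 : (1 + y₁) * (1 + y₂) ≤ 4 := by nlinarith
    have h2 : 2 * (s₁ * s₂) ≤ y₁ + y₂ := by nlinarith [sq_nonneg (s₁ - s₂)]
    have h3 : (x + y₁) ^ 2 ≤ (η x + y₁) ^ 2 := by gcongr
    have h4 : (x + y₂) ^ 2 ≤ (η x + y₂) ^ 2 := by gcongr
    nlinarith [mul_le_mul_of_nonneg_right h1 (sq_nonneg x), mul_le_mul_of_nonneg_right h2 h0,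
      sq_nonneg y₁, sq_nonneg y₂]
  · have hη := h.le_apply (x := -x) (by linarith) (by linarith)
    rw [h.odd] at hη
    wlog hle : y₁ ≤ y₂ generalizing y₁ y₂ s₁ s₂ with H
    · have := H hy₂ hy₂' hy₁ hy₁' hs₂ hn₂ hs₁ hn₁ (le_of_not_ge hle)
      nlinarith
    have hss : y₁ ≤ s₁ * s₂ := by
      have : s₁ ≤ s₂ := abs_le_of_sq_le_sq' (by linarith) hn₂ |>.2
      nlinarith
    obtain ⟨z, rfl⟩ : ∃ z, x = -z := ⟨-x, by ring⟩
    have hz : 0 ≤ z := by linarith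
    have hz1 : z ≤ 1 := by linarith
    have h1 : (1 + y₁) * (1 + y₂) ≤ 2 * (1 + y₁) := by nlinarith
    have h2 := mul_le_mul_of_nonneg_right h1 (sq_nonneg z)
    have h3 := mul_le_mul_of_nonneg_right hss hz
    rcases le_total z y₁ with h4 | h4
    · nlinarith [sq_nonneg (η (-z) + y₁), sq_nonneg (η (-z) + y₂), mul_nonneg hz hz,
        mul_le_mul_of_nonneg_right h4 hz, mul_le_mul_of_nonneg_right hy₁' (sq_nonneg z)]
    · have h5 : (z - y₁) ^ 2 ≤ (η (-z) + y₁) ^ 2 := by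
        rw [← neg_sq (η (-z) + y₁)]
        have : 0 ≤ z - y₁ := by linarith
        gcongr
        linarith
      nlinarith [sq_nonneg (η (-z) + y₂), mul_nonneg hy₁ hz,
        mul_le_mul_of_nonneg_right hz1 (mul_nonneg hy₁ hz), sq_nonneg y₁]

end IsOddLink

theorem logistic_eq_sigmoid (β x : ℝ) : logistic β x = Real.sigmoid (β * x) := by
  rw [logistic, Real.sigmoid_def, Real.exp_neg]
  have := Real.exp_pos (β * x)
  field_simp
  ring

theorem concaveOn_sigmoid : ConcaveOn ℝ (Set.Ici 0) Real.sigmoid := by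
  refine AntitoneOn.concaveOn_of_deriv (convex_Ici 0) continuous_sigmoid.continuousOn
    differentiable_sigmoid.differentiableOn ?_
  intro x hx y hy hxy
  rw [interior_Ici, Set.mem_Ioi] at hx hy
  rw [Real.deriv_sigmoid]
  have h1 := Real.sigmoid_le hxy
  have h2 := Real.sigmoid_le hx.le
  rw [Real.sigmoid_zero] at h2
  have : (2 : ℝ)⁻¹ = 1 / 2 := by norm_num
  nlinarith

theorem half_lt_logistic_one {β : ℝ} (hβ : 0 < β) : 1 / 2 < logistic β 1 := by
  rw [logistic_eq_sigmoid]
  have := Real.sigmoid_lt (show 0 < β * 1 by linarith)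
  rw [Real.sigmoid_zero] at this
  linarith

/-- The logistic link, centred and scaled. -/
def oddLogistic (β x : ℝ) : ℝ := (logistic β x - 1 / 2) / (logistic β 1 - 1 / 2)

theorem isOddLink_oddLogistic {β : ℝ} (hβ : 0 < β) : IsOddLink (oddLogistic β) := by
  have hp := sub_pos.2 (half_lt_logistic_one hβ)
  refine ⟨?_, ?_, ?_, ?_⟩
  · intro x y hxy
    unfold oddLogistic
    rw [logistic_eq_sigmoid β x, logistic_eq_sigmoid β y]
    gcongr
  · intro x
    unfold oddLogistic
    rw [logistic_eq_sigmoid β (-x), logistic_eq_sigmoid β x, mul_neg, Real.sigmoid_neg]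
    ring
  · have h1 : ConcaveOn ℝ (Set.Icc 0 1) fun x => logistic β x := by
      refine ⟨convex_Icc 0 1, fun x hx y hy a b ha hb hab => ?_⟩
      have := concaveOn_sigmoid.2 (mul_nonneg hβ.le hx.1) (mul_nonneg hβ.le hy.1) ha hb hab
      simp only [logistic_eq_sigmoid, smul_eq_mul] at this ⊢
      convert this using 2
      ring
    refine ⟨convex_Icc 0 1, fun x hx y hy a b ha hb hab => ?_⟩
    have := h1.2 hx hy ha hb hab
    simp only [oddLogistic, smul_eq_mul] at this ⊢
    rw [← mul_div_assoc, ← mul_div_assoc, ← add_div]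
    gcongr
    have : a * (1 / 2) + b * (1 / 2) = (1 / 2 : ℝ) := by rw [← add_mul, hab, one_mul]
    linarith
  · exact div_self hp.ne'

theorem continuous_logistic (β : ℝ) : Continuous (logistic β) := by
  have : logistic β = fun x => Real.sigmoid (β * x) := funext (logistic_eq_sigmoid β)
  rw [this]
  exact continuous_sigmoid.comp (by fun_prop)

/-- The centred logistic link takes each value in `[0, 1]` at a point of `[0, 1]` which depends
measurably on the value. -/
theorem exists_measurable_rightInverse_oddLogistic {β : ℝ} (hβ : 0 < β) :
    ∃ σ : ℝ → ℝ, Measurable σ ∧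
      ∀ y, 0 ≤ y → y ≤ 1 → 0 ≤ σ y ∧ σ y ≤ 1 ∧ oddLogistic β (σ y) = y := by
  have hp := sub_pos.2 (half_lt_logistic_one hβ)
  set F := logistic β 1 - 1 / 2 with hF
  let q : ℝ → ℝ := fun y => 1 / 2 + F * y
  refine ⟨fun y => Real.log (q y / (1 - q y)) / β, by fun_prop, fun y h0 h1 => ?_⟩
  have hlt : logistic β 1 < 1 := by rw [logistic_eq_sigmoid]; exact Real.sigmoid_lt_one _
  have hq0 : 1 / 2 ≤ q y := by simp only [q]; nlinarith
  have hq1 : q y ≤ logistic β 1 := by simp only [q]; nlinarith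
  have hval : oddLogistic β (Real.log (q y / (1 - q y)) / β) = y := by
    have h2 : logistic β (Real.log (q y / (1 - q y)) / β) = q y := by
      have h3 : 0 < 1 - q y := by linarith
      rw [logistic, mul_div_cancel₀ _ hβ.ne', Real.exp_log (div_pos (by linarith) h3)]
      field_simp
      ring
    rw [oddLogistic, h2, ← hF]
    simp only [q]
    field_simp
    ring
  have hstrict : ∀ a b, logistic β a ≤ logistic β b → a ≤ b := by
    intro a b hab
    rw [logistic_eq_sigmoid, logistic_eq_sigmoid, Real.sigmoid_le_iff] at hab
    exact le_of_mul_le_mul_left hab hβ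
  have hh : ∀ a, oddLogistic β a = y → logistic β a = q y := by
    intro a ha
    rw [oddLogistic, ← hF, div_eq_iff hp.ne'] at ha
    simp only [q]; linarith
  refine ⟨hstrict _ _ ?_, hstrict _ _ ?_, hval⟩
  · rw [hh _ hval, logistic_eq_sigmoid, mul_zero, Real.sigmoid_zero]; linarith
  · rw [hh _ hval]; exact hq1

/-! ### Regret and variance for an odd link -/

section MeanRegret

variable {α : Type*} [MeasurableSpace α] {d : ℕ}

theorem abs_inner_le_one_of_norm_eq_one {u v : Vec d} (hu : ‖u‖ = 1) (hv : ‖v‖ = 1) :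
    |inner ℝ u v| ≤ 1 := by
  simpa [hu, hv] using abs_real_inner_le_norm u v

theorem add_sq_le_of_sq_le_mul {r s A B p q : ℝ} (hA : 0 ≤ A) (hB : 0 ≤ B) (hp : 0 ≤ p)
    (hq : 0 ≤ q) (hr : r ^ 2 ≤ A * p) (hs : s ^ 2 ≤ B * q) :
    (r + s) ^ 2 ≤ (A + B) * (p + q) := by
  have h1 : (r * s) ^ 2 ≤ (A * q) * (B * p) := by
    rw [mul_pow]
    nlinarith [mul_le_mul hr hs (sq_nonneg s) (mul_nonneg hA hp)]
  have h2 : 2 * (r * s) ≤ A * q + B * p := by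
    refine abs_le_of_sq_le_sq' ?_ (by positivity) |>.2
    nlinarith [sq_nonneg (A * q - B * p)]
  nlinarith

variable {ν : Measure α} {e : α → Vec d} {η σ : ℝ → ℝ}

theorem measurable_inner_prod (he : Measurable e) :
    Measurable fun p : α × α => inner ℝ (e p.1) (e p.2) := by
  fun_prop

/-- The mean `E[η ⟪e a, e θ⟫]` over the random parameter `θ`, for the action `a`. -/
def linkMean (ν : Measure α) (e : α → Vec d) (η : ℝ → ℝ) (a : α) : ℝ :=
  ∫ θ, η (inner ℝ (e a) (e θ)) ∂ν

/-- The variance of `η ⟪e a, e θ⟫` over the random parameter `θ`, for the action `a`. -/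
def linkVar (ν : Measure α) (e : α → Vec d) (η : ℝ → ℝ) (a : α) : ℝ :=
  ∫ θ, (η (inner ℝ (e a) (e θ)) - linkMean ν e η a) ^ 2 ∂ν

theorem linkVar_nonneg (a : α) : 0 ≤ linkVar ν e η a := integral_nonneg fun _ => sq_nonneg _

variable [IsProbabilityMeasure ν]

theorem measurable_linkMean (he : Measurable e) (hη : Measurable η) :
    Measurable (linkMean ν e η) :=
  (StronglyMeasurable.integral_prod_right' (f := fun p : α × α => η (inner ℝ (e p.1) (e p.2)))
    (hη.comp (measurable_inner_prod he)).stronglyMeasurable).measurable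

theorem measurable_linkVar (he : Measurable e) (hη : Measurable η) :
    Measurable (linkVar ν e η) := by
  have h := measurable_linkMean (ν := ν) he hη
  have h1 : Measurable fun p : α × α =>
      (η (inner ℝ (e p.1) (e p.2)) - linkMean ν e η p.1) ^ 2 :=
    ((hη.comp (measurable_inner_prod he)).sub (h.comp measurable_fst)).pow_const 2
  exact (StronglyMeasurable.integral_prod_right' h1.stronglyMeasurable).measurable

theorem abs_linkMean_le (h1 : ∀ a, ‖e a‖ = 1) (hη : IsOddLink η) (a : α) :
    |linkMean ν e η a| ≤ 1 := by
  have := norm_integral_le_of_norm_le_const (μ := ν) (f := fun θ => η (inner ℝ (e a) (e θ)))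
    (C := 1) (.of_forall fun θ => hη.abs_le_one (abs_inner_le_one_of_norm_eq_one (h1 a) (h1 θ)))
  simpa [linkMean] using this

theorem sq_link_sub_linkMean_le (h1 : ∀ a, ‖e a‖ = 1) (hη : IsOddLink η) (a θ : α) :
    (η (inner ℝ (e a) (e θ)) - linkMean ν e η a) ^ 2 ≤ 4 := by
  have h2 := abs_le.1 (hη.abs_le_one (abs_inner_le_one_of_norm_eq_one (h1 a) (h1 θ)))
  have h3 := abs_le.1 (abs_linkMean_le (ν := ν) h1 hη a)
  nlinarith

theorem integrable_sq_link_sub_linkMean (he : Measurable e) (h1 : ∀ a, ‖e a‖ = 1)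
    (hη : IsOddLink η) (a : α) :
    Integrable (fun θ => (η (inner ℝ (e a) (e θ)) - linkMean ν e η a) ^ 2) ν := by
  have hm := hη.monotone.measurable
  refine integrable_of_measurable_bounded (by fun_prop) (C := 4) fun θ => ?_
  rw [abs_of_nonneg (sq_nonneg _)]
  exact sq_link_sub_linkMean_le h1 hη a θ

theorem linkVar_le (h1 : ∀ a, ‖e a‖ = 1) (hη : IsOddLink η) (a : α) :
    linkVar ν e η a ≤ 4 := by
  refine (integral_mono_of_nonneg (.of_forall fun _ => sq_nonneg _) (integrable_const (4 : ℝ))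
    (.of_forall fun θ => sq_link_sub_linkMean_le h1 hη a θ)).trans ?_
  simp

/-- The contribution of the actions of nonnegative mean to the regret is at most the square root of
`d + 1` times their contribution to the mean variance: for those, the deviation of the link from its
mean dominates that of a chord, and the chords define a kernel of rank at most `d + 1` whose trace
is the regret. -/
theorem sq_regret_nonneg_part_le (he : Measurable e) (h1 : ∀ a, ‖e a‖ = 1) (hη : IsOddLink η)
    (hσ : Measurable σ) (hσ' : ∀ y, 0 ≤ y → y ≤ 1 → 0 ≤ σ y ∧ σ y ≤ 1 ∧ η (σ y) = y) :
    (∫ a, {a | 0 ≤ linkMean ν e η a}.indicator (fun a => 1 - linkMean ν e η a) a ∂ν) ^ 2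
      ≤ (d + 1) * ∫ a, {a | 0 ≤ linkMean ν e η a}.indicator (linkVar ν e η) a ∂ν := by
  have hηm := hη.monotone.measurable
  set m := linkMean ν e η with hm_def
  have hm : Measurable m := measurable_linkMean he hηm
  have hm1 : ∀ a, |m a| ≤ 1 := abs_linkMean_le h1 hη
  set S : Set α := {a | 0 ≤ m a} with hS_def
  have hS : MeasurableSet S := measurableSet_le measurable_const hm
  -- the slope of the chord; it vanishes by `0 / 0 = 0` where the mean is `1`
  let lam : α → ℝ := S.indicator fun a => (1 - m a) / (1 - σ (m a))
  have hlam : Measurable lam := Measurable.indicator (by fun_prop) hS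
  have hx₀ : ∀ a ∈ S, 0 ≤ σ (m a) ∧ σ (m a) ≤ 1 ∧ η (σ (m a)) = m a := fun a ha =>
    hσ' _ ha (abs_le.1 (hm1 a)).2
  have hlam_abs : ∀ a, |lam a| ≤ 1 := by
    intro a
    by_cases ha : a ∈ S
    · obtain ⟨h2, h3, h4⟩ := hx₀ a ha
      have h5 := hη.le_apply h2 h3
      rw [h4] at h5
      have h6 := (abs_le.1 (hm1 a)).2
      simp only [lam, Set.indicator_of_mem ha]
      rw [abs_of_nonneg (div_nonneg (by linarith) (by linarith))]
      exact div_le_one_of_le₀ (by linarith) (by linarith)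
    · simp [lam, Set.indicator_of_notMem ha]
  let s₀ : α → ℝ := S.indicator fun a => σ (m a)
  have hs₀ : Measurable s₀ := Measurable.indicator (by fun_prop) hS
  have hs₀_abs : ∀ a, |s₀ a| ≤ 1 := by
    intro a
    by_cases ha : a ∈ S
    · obtain ⟨h2, h3, h4⟩ := hx₀ a ha
      simp only [s₀, Set.indicator_of_mem ha]
      rwa [abs_of_nonneg h2]
    · simp [s₀, Set.indicator_of_notMem ha]
  let b : α → EuclideanSpace ℝ (Option (Fin d)) := fun a =>
    WithLp.toLp 2 fun o => o.elim (-(lam a * s₀ a)) fun i => lam a * e a i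
  let ψ : α → EuclideanSpace ℝ (Option (Fin d)) := fun θ =>
    WithLp.toLp 2 fun o => o.elim 1 fun i => e θ i
  have hei : ∀ i, Measurable fun a => e a i := fun i => by fun_prop
  have hb : Measurable b := by
    refine (WithLp.measurable_toLp 2 _).comp (measurable_pi_lambda _ fun o => ?_)
    cases o with
    | none => exact (hlam.mul hs₀).neg
    | some i => exact hlam.mul (hei i)
  have hψ : Measurable ψ := by
    refine (WithLp.measurable_toLp 2 _).comp (measurable_pi_lambda _ fun o => ?_)
    cases o with
    | none => exact measurable_const
    | some i => exact hei i
  have hinner : ∀ a θ, inner ℝ (b a) (ψ θ) = lam a * (inner ℝ (e a) (e θ) - s₀ a) := by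
    intro a θ
    simp only [PiLp.inner_apply, RCLike.inner_apply, conj_trivial, Fintype.sum_option, b, ψ,
      Option.elim, mul_sub, Finset.mul_sum]
    rw [one_mul, add_comm, sub_eq_add_neg]
    congr 1
    exact Finset.sum_congr rfl fun i _ => by ring
  have hsum : ∀ a, ∑ i, e a i ^ 2 = 1 := by
    intro a
    have := EuclideanSpace.real_norm_sq_eq (e a)
    rw [h1] at this
    linarith
  have hbC : ∀ a, ‖b a‖ ≤ 2 := by
    intro a
    refine abs_le_of_sq_le_sq' ?_ (by norm_num) |>.2
    rw [EuclideanSpace.real_norm_sq_eq]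
    simp only [Fintype.sum_option, b, Option.elim, mul_pow, neg_sq, ← Finset.mul_sum, hsum]
    have h2 := (sq_le_one_iff_abs_le_one _).2 (hlam_abs a)
    have h3 := (sq_le_one_iff_abs_le_one _).2 (hs₀_abs a)
    nlinarith [sq_nonneg (lam a)]
  have hψC : ∀ a, ‖ψ a‖ ≤ 2 := by
    intro a
    refine abs_le_of_sq_le_sq' ?_ (by norm_num) |>.2
    rw [EuclideanSpace.real_norm_sq_eq]
    simp only [Fintype.sum_option, ψ, Option.elim, hsum]
    norm_num
  have key := sq_integral_inner_le_card_mul (ν := ν) hb hψ hbC hψC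
  have hdiag : ∀ a, inner ℝ (b a) (ψ a) = S.indicator (fun a => 1 - m a) a := by
    intro a
    rw [hinner, real_inner_self_eq_norm_sq, h1]
    by_cases ha : a ∈ S
    · simp only [lam, s₀, Set.indicator_of_mem ha]
      obtain ⟨h2, h3, h4⟩ := hx₀ a ha
      rcases h3.eq_or_lt with h5 | h5
      · rw [← h4, h5, hη.map_one]; simp
      · have : 1 - σ (m a) ≠ 0 := by linarith
        field_simp
    · simp [lam, Set.indicator_of_notMem ha]
  have hoff : ∀ a, ∫ θ, inner ℝ (b a) (ψ θ) ^ 2 ∂ν ≤ S.indicator (linkVar ν e η) a := by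
    intro a
    by_cases ha : a ∈ S
    · rw [Set.indicator_of_mem ha]
      refine integral_mono_of_nonneg (.of_forall fun _ => sq_nonneg _)
        (integrable_sq_link_sub_linkMean he h1 hη a) (.of_forall fun θ => ?_)
      obtain ⟨h2, h3, h4⟩ := hx₀ a ha
      simp only [hinner, lam, s₀, Set.indicator_of_mem ha]
      rcases h3.eq_or_lt with h5 | h5
      · rw [h5]; simpa using sq_nonneg _
      · have h6 := hη.chord_mul_abs_le h2 h5 (abs_inner_le_one_of_norm_eq_one (h1 a) (h1 θ))
        rw [h4] at h6
        refine sq_le_sq.2 (le_trans ?_ h6)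
        rw [abs_mul, abs_of_nonneg (div_nonneg (by linarith [(abs_le.1 (hm1 a)).2])
          (by linarith))]
    · simp [Set.indicator_of_notMem ha, hinner, lam]
  simp_rw [hdiag] at key
  refine key.trans ?_
  rw [Fintype.card_option, Fintype.card_fin]
  push_cast
  refine mul_le_mul_of_nonneg_left ?_ (by positivity)
  refine integral_mono_of_nonneg (.of_forall fun _ => integral_nonneg fun _ => sq_nonneg _) ?_
    (.of_forall hoff)
  exact (integrable_of_measurable_bounded (measurable_linkVar he hηm) (C := 4) fun a => by
    rw [abs_of_nonneg (linkVar_nonneg a)]; exact linkVar_le h1 hη a).indicator hS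

/-- The contribution of the actions of negative mean to the regret is at most the square root of
`4 d` times their contribution to the mean variance. The regret of such an action serves as its
weight `w = 1 - m`: the kernel `√(w a) √(w θ) ⟪e a, e θ⟫` has rank at most `d`, and its trace is the
total regret. Its square is compared with the variances up to a multiple of the positive
semidefinite kernel `√(-m a) √(-m θ) ⟪e a, e θ⟫`. -/
theorem sq_regret_neg_part_le (he : Measurable e) (h1 : ∀ a, ‖e a‖ = 1) (hη : IsOddLink η) :
    (∫ a, {a | 0 ≤ linkMean ν e η a}ᶜ.indicator (fun a => 1 - linkMean ν e η a) a ∂ν) ^ 2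
      ≤ 4 * d * ∫ a, {a | 0 ≤ linkMean ν e η a}ᶜ.indicator (linkVar ν e η) a ∂ν := by
  have hηm := hη.monotone.measurable
  set m := linkMean ν e η with hm_def
  have hm : Measurable m := measurable_linkMean he hηm
  have hm1 : ∀ a, |m a| ≤ 1 := abs_linkMean_le h1 hη
  set S : Set α := {a | 0 ≤ m a}ᶜ with hS_def
  have hS : MeasurableSet S := (measurableSet_le measurable_const hm).compl
  let w : α → ℝ := S.indicator fun a => 1 - m a
  have hw : Measurable w := Measurable.indicator (by fun_prop) hS
  have hw0 : ∀ a, 0 ≤ w a := fun a =>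
    Set.indicator_nonneg (fun a _ => by linarith [(abs_le.1 (hm1 a)).2]) a
  have hw2 : ∀ a, w a ≤ 4 := fun a =>
    Set.indicator_apply_le' (fun _ => by linarith [(abs_le.1 (hm1 a)).1]) (fun _ => by norm_num)
  let b : α → Vec d := fun a => √(w a) • e a
  have hb : Measurable b := by fun_prop
  have hbC : ∀ a, ‖b a‖ ≤ 2 := by
    intro a
    rw [norm_smul, h1, mul_one, Real.norm_of_nonneg (Real.sqrt_nonneg _)]
    exact Real.sqrt_le_iff.2 ⟨by norm_num, by norm_num; exact hw2 a⟩
  have key := sq_integral_inner_le_card_mul (ν := ν) hb hb hbC hbC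
  have hdiag : ∀ a, inner ℝ (b a) (b a) = S.indicator (fun a => 1 - m a) a := by
    intro a
    rw [real_inner_self_eq_norm_sq, norm_smul, h1, mul_one,
      Real.norm_of_nonneg (Real.sqrt_nonneg _), Real.sq_sqrt (hw0 a)]
  have hoff : ∀ a θ, inner ℝ (b a) (b θ) ^ 2 = w a * w θ * inner ℝ (e a) (e θ) ^ 2 := by
    intro a θ
    simp only [b, real_inner_smul_left, real_inner_smul_right]
    rw [← mul_assoc, mul_pow, mul_pow, Real.sq_sqrt (hw0 a), Real.sq_sqrt (hw0 θ),
      mul_comm (w θ)]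
  let D : α → α → ℝ := fun a θ => S.indicator (fun a => (η (inner ℝ (e a) (e θ)) - m a) ^ 2) a
  have hpoint : ∀ a θ, 2 * inner ℝ (b a) (b θ) ^ 2
      + 16 * (√(-m a) * √(-m θ) * inner ℝ (e a) (e θ)) ≤ 4 * (D a θ + D θ a) := by
    intro a θ
    rw [hoff]
    have hD0 : ∀ a θ, 0 ≤ D a θ := fun a θ => Set.indicator_nonneg (fun _ _ => sq_nonneg _) _
    have hnot : ∀ a, a ∉ S → √(-m a) = 0 := by
      intro a ha
      rw [hS_def, Set.notMem_compl_iff] at ha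
      exact Real.sqrt_eq_zero_of_nonpos (neg_nonpos.2 ha)
    by_cases ha : a ∈ S
    · by_cases hθ : θ ∈ S
      · simp only [D, w, Set.indicator_of_mem ha, Set.indicator_of_mem hθ]
        have h2 : m a < 0 := not_le.1 ha
        have h3 : m θ < 0 := not_le.1 hθ
        have := hη.two_mul_sq_add_le (abs_inner_le_one_of_norm_eq_one (h1 a) (h1 θ))
          (y₁ := -m a) (y₂ := -m θ) (by linarith) (by linarith [(abs_le.1 (hm1 a)).1])
          (by linarith) (by linarith [(abs_le.1 (hm1 θ)).1])
        rw [real_inner_comm (e a) (e θ)]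
        simp only [← sub_eq_add_neg] at this
        linarith
      · rw [hnot θ hθ]
        simp only [w, Set.indicator_of_notMem hθ]
        linarith [hD0 a θ, hD0 θ a]
    · rw [hnot a ha]
      simp only [w, Set.indicator_of_notMem ha]
      linarith [hD0 a θ, hD0 θ a]
  -- the kernel `√(-m a) √(-m θ) ⟪e a, e θ⟫` is positive semidefinite
  let u : α → Vec d := fun a => √(-m a) • e a
  have hu : Measurable u := by fun_prop
  have hu1 : ∀ a, ‖u a‖ ≤ 1 := by
    intro a
    rw [norm_smul, h1, mul_one, Real.norm_of_nonneg (Real.sqrt_nonneg _)]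
    exact Real.sqrt_le_iff.2 ⟨by norm_num, by linarith [(abs_le.1 (hm1 a)).1]⟩
  have hui : Integrable u ν := Integrable.of_bound hu.aestronglyMeasurable 1 (.of_forall hu1)
  have huu : ∀ a θ, √(-m a) * √(-m θ) * inner ℝ (e a) (e θ) = inner ℝ (u a) (u θ) := by
    intro a θ
    simp only [u, real_inner_smul_left, real_inner_smul_right]
    ring
  have hpsd : 0 ≤ ∫ p : α × α, inner ℝ (u p.1) (u p.2) ∂(ν.prod ν) := by
    rw [integral_prod]
    · have : ∀ a, ∫ θ, inner ℝ (u a) (u θ) ∂ν = inner ℝ (u a) (∫ θ, u θ ∂ν) := fun a =>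
        integral_inner hui _
      simp_rw [this, real_inner_comm (∫ θ, u θ ∂ν)]
      rw [integral_inner hui]
      exact real_inner_self_nonneg
    · refine integrable_of_measurable_bounded (by fun_prop) (C := 1) fun p => ?_
      refine (abs_real_inner_le_norm _ _).trans ?_
      exact mul_le_one₀ (hu1 _) (norm_nonneg _) (hu1 _)
  have hDm : Measurable fun p : α × α => D p.1 p.2 := by
    have : (fun p : α × α => D p.1 p.2) = (Prod.fst ⁻¹' S).indicator
        fun p : α × α => (η (inner ℝ (e p.1) (e p.2)) - m p.1) ^ 2 := by
      ext p
      simp only [D, Set.indicator, Set.mem_preimage]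
    rw [this]
    refine Measurable.indicator ?_ (measurable_fst hS)
    fun_prop
  have hDi : Integrable (fun p : α × α => D p.1 p.2) (ν.prod ν) := by
    refine integrable_of_measurable_bounded hDm (C := 4) fun p => ?_
    rw [abs_of_nonneg (Set.indicator_nonneg (fun _ _ => sq_nonneg _) _)]
    exact Set.indicator_apply_le' (fun _ => sq_link_sub_linkMean_le h1 hη _ _)
      (fun _ => by norm_num)
  have hDV : ∫ p : α × α, D p.1 p.2 ∂(ν.prod ν) = ∫ a, S.indicator (linkVar ν e η) a ∂ν := by
    rw [integral_prod _ hDi]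
    congr 1
    ext a
    by_cases ha : a ∈ S
    · simp only [D, Set.indicator_of_mem ha]; rfl
    · simp [D, Set.indicator_of_notMem ha]
  have hDswap : ∫ p : α × α, D p.2 p.1 ∂(ν.prod ν) = ∫ p : α × α, D p.1 p.2 ∂(ν.prod ν) :=
    integral_prod_swap fun p : α × α => D p.1 p.2
  have hDi' : Integrable (fun p : α × α => D p.2 p.1) (ν.prod ν) := hDi.swap
  have hbi : Integrable (fun p : α × α => inner ℝ (b p.1) (b p.2) ^ 2) (ν.prod ν) := by
    refine integrable_of_measurable_bounded (by fun_prop) (C := (2 * 2) ^ 2) fun p => ?_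
    rw [abs_pow]
    gcongr
    exact (abs_real_inner_le_norm _ _).trans (by gcongr <;> exact hbC _)
  have hui2 : Integrable (fun p : α × α => inner ℝ (u p.1) (u p.2)) (ν.prod ν) := by
    refine integrable_of_measurable_bounded (by fun_prop) (C := 1) fun p => ?_
    refine (abs_real_inner_le_norm _ _).trans ?_
    exact mul_le_one₀ (hu1 _) (norm_nonneg _) (hu1 _)
  have hint : 2 * ∫ p : α × α, inner ℝ (b p.1) (b p.2) ^ 2 ∂(ν.prod ν)
      ≤ 8 * ∫ a, S.indicator (linkVar ν e η) a ∂ν := by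
    have h2 : ∫ p : α × α, (2 * inner ℝ (b p.1) (b p.2) ^ 2 + 16 * inner ℝ (u p.1) (u p.2))
        ∂(ν.prod ν) ≤ ∫ p : α × α, 4 * (D p.1 p.2 + D p.2 p.1) ∂(ν.prod ν) := by
      refine integral_mono ((hbi.const_mul 2).add (hui2.const_mul 16))
        ((hDi.add hDi').const_mul 4) fun p => ?_
      have := hpoint p.1 p.2
      rwa [huu] at this
    rw [integral_add (hbi.const_mul 2) (hui2.const_mul 16), integral_const_mul,
      integral_const_mul, integral_const_mul, integral_add hDi hDi', hDswap, hDV] at h2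
    linarith
  rw [integral_prod _ hbi] at hint
  simp_rw [hdiag] at key
  rw [Fintype.card_fin] at key
  have hd : (0 : ℝ) ≤ d := by positivity
  nlinarith [mul_le_mul_of_nonneg_left hint hd]

/-- The square of the mean regret is at most `6 d` times the mean variance. -/
theorem sq_one_sub_integral_linkMean_le (hd : 1 ≤ d) (he : Measurable e) (h1 : ∀ a, ‖e a‖ = 1)
    (hη : IsOddLink η) (hσ : Measurable σ)
    (hσ' : ∀ y, 0 ≤ y → y ≤ 1 → 0 ≤ σ y ∧ σ y ≤ 1 ∧ η (σ y) = y) :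
    (1 - ∫ a, linkMean ν e η a ∂ν) ^ 2 ≤ 6 * d * ∫ a, linkVar ν e η a ∂ν := by
  have hηm := hη.monotone.measurable
  have hm : Measurable (linkMean ν e η) := measurable_linkMean he hηm
  have hS : MeasurableSet {a | 0 ≤ linkMean ν e η a} := measurableSet_le measurable_const hm
  have hmi : Integrable (linkMean ν e η) ν :=
    integrable_of_measurable_bounded hm (abs_linkMean_le h1 hη)
  have hmi' : Integrable (fun a => 1 - linkMean ν e η a) ν := (integrable_const 1).sub hmi
  have hVi : Integrable (linkVar ν e η) ν :=
    integrable_of_measurable_bounded (measurable_linkVar he hηm) (C := 4) fun a => by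
      rw [abs_of_nonneg (linkVar_nonneg a)]; exact linkVar_le h1 hη a
  have hA := sq_regret_nonneg_part_le (ν := ν) he h1 hη hσ hσ'
  have hB := sq_regret_neg_part_le (ν := ν) he h1 hη
  have hsplit : ∀ {f : α → ℝ}, Integrable f ν →
      ∫ a, f a ∂ν = ∫ a, {a | 0 ≤ linkMean ν e η a}.indicator f a ∂ν
        + ∫ a, {a | 0 ≤ linkMean ν e η a}ᶜ.indicator f a ∂ν := by
    intro f hf
    rw [integral_indicator hS, integral_indicator hS.compl, integral_add_compl hS hf]
  have hreg : 1 - ∫ a, linkMean ν e η a ∂ν = ∫ a, (1 - linkMean ν e η a) ∂ν := by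
    rw [integral_sub (integrable_const 1) hmi]
    simp
  have hd' : (1 : ℝ) ≤ d := by exact_mod_cast hd
  have hVn : 0 ≤ ∫ a, linkVar ν e η a ∂ν := integral_nonneg fun a => linkVar_nonneg a
  rw [hreg, hsplit hmi']
  refine (add_sq_le_of_sq_le_mul (by positivity) (by positivity)
    (integral_nonneg fun a => Set.indicator_nonneg (fun a _ => linkVar_nonneg a) a)
    (integral_nonneg fun a => Set.indicator_nonneg (fun a _ => linkVar_nonneg a) a) hA hB).trans ?_
  rw [← hsplit hVi]
  gcongr
  linarith

end MeanRegret

/-! ### Lower bounds for the divergence, and the reward law -/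

section

/-- Young's inequality for the pair of conjugate functions `klFun` and `exp - 1`. -/
theorem mul_le_klFun_add_exp_sub_one {u : ℝ} (hu : 0 ≤ u) (g : ℝ) :
    u * g ≤ klFun u + (Real.exp g - 1) := by
  rw [klFun_apply]
  rcases hu.eq_or_lt with rfl | hu
  · have := Real.exp_pos g
    simp [this.le]
  · have h1 : Real.exp g = u * Real.exp (g - Real.log u) := by
      rw [Real.exp_sub, Real.exp_log hu]
      field_simp
    have h2 := Real.add_one_le_exp (g - Real.log u)
    rw [h1]
    nlinarith

/-- A variational lower bound for the Kullback–Leibler divergence, in the manner of Donsker and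
Varadhan. -/
theorem ofReal_integral_le_klDiv {𝒳 : Type*} [MeasurableSpace 𝒳] {J P : Measure 𝒳}
    [IsProbabilityMeasure J] [IsProbabilityMeasure P] {g : 𝒳 → ℝ} (hg : Measurable g) {C : ℝ}
    (hC : ∀ x, |g x| ≤ C) (hP : ∫ x, Real.exp (g x) ∂P ≤ 1) :
    ENNReal.ofReal (∫ x, g x ∂J) ≤ klDiv J P := by
  by_cases hac : J ≪ P
  swap; · simp [klDiv_of_not_ac hac]
  by_cases hint : Integrable (llr J P) J
  swap; · simp [klDiv_of_not_integrable hint]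
  rw [klDiv_eq_integral_klFun, if_pos ⟨hac, hint⟩]
  refine ENNReal.ofReal_le_ofReal ?_
  have hgJ : Integrable g J := integrable_of_measurable_bounded hg hC
  have hexp : Integrable (fun x => Real.exp (g x)) P := by
    refine integrable_of_measurable_bounded (by fun_prop) (C := Real.exp C) fun x => ?_
    rw [Real.abs_exp]
    exact Real.exp_le_exp.2 ((le_abs_self _).trans (hC x))
  have hkl : Integrable (fun x => klFun (J.rnDeriv P x).toReal) P :=
    (integrable_klFun_rnDeriv_iff hac).2 hint
  have h1 : ∫ x, g x ∂J = ∫ x, (J.rnDeriv P x).toReal * g x ∂P := by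
    rw [← integral_rnDeriv_smul hac]
    simp [smul_eq_mul]
  have h2 : Integrable (fun x => (J.rnDeriv P x).toReal * g x) P := by
    simpa [smul_eq_mul] using (integrable_rnDeriv_smul_iff hac).2 hgJ
  have h3 : Integrable (fun x => Real.exp (g x) - 1) P := hexp.sub (integrable_const 1)
  have h4 := integral_mono h2 (hkl.add h3) fun x =>
    mul_le_klFun_add_exp_sub_one ENNReal.toReal_nonneg (g x)
  have h5 : ∫ x, (klFun (J.rnDeriv P x).toReal + (Real.exp (g x) - 1)) ∂P
      = ∫ x, klFun (J.rnDeriv P x).toReal ∂P + (∫ x, Real.exp (g x) ∂P - 1) := by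
    rw [integral_add hkl h3, integral_sub hexp (integrable_const 1)]
    simp
  simp only [Pi.add_apply] at h4
  rw [h5] at h4
  rw [h1]
  linarith

/-- Hoeffding's lemma for a Bernoulli variable of parameter `q`, with the moment generating function
at `4 D` normalised. -/
theorem bernoulli_exp_le_one {q : ℝ} (hq : q ∈ unitInterval) (D : ℝ) :
    q * Real.exp (4 * D * (1 - q) - 2 * D ^ 2)
      + (1 - q) * Real.exp (4 * D * (0 - q) - 2 * D ^ 2) ≤ 1 := by
  have hb : ∀ᵐ r ∂(bernoulliMeasure (1 : ℝ) 0 ⟨q, hq⟩), r ∈ Set.Icc (0 : ℝ) 1 := by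
    rw [ae_iff]
    exact bernoulliMeasure_apply_of_notMem_of_notMem _ measurableSet_Icc.compl (by simp) (by simp)
  have h := (hasSubgaussianMGF_of_mem_Icc (X := id) aemeasurable_id hb).mgf_le (4 * D)
  rw [mgf, integral_bernoulliMeasure, integral_bernoulliMeasure] at h
  have e : ∀ r : ℝ, Real.exp (4 * D * (r - q) - 2 * D ^ 2)
      = Real.exp (4 * D * (r - q)) * Real.exp (-(2 * D ^ 2)) := fun r => by
    rw [← Real.exp_add, sub_eq_add_neg]
  rw [e, e, ← mul_assoc, ← mul_assoc, ← add_mul, Real.exp_neg, ← div_eq_mul_inv,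
    div_le_one (Real.exp_pos _)]
  have e' : (((‖(1 : ℝ) - 0‖₊ / 2) ^ 2 : NNReal) : ℝ) * (4 * D) ^ 2 / 2 = 2 * D ^ 2 := by
    simp only [sub_zero, nnnorm_one, NNReal.coe_pow, NNReal.coe_div, NNReal.coe_one,
      NNReal.coe_ofNat]
    ring
  rw [e'] at h
  simpa using h

variable {d : ℕ}

theorem logistic_nonneg (β x : ℝ) : 0 ≤ logistic β x := (logistic_mem_unitInterval β x).1

theorem logistic_le_one (β x : ℝ) : logistic β x ≤ 1 := (logistic_mem_unitInterval β x).2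

instance isProbabilityMeasure_rewardLaw (β : ℝ) (a θ : Vec d) :
    IsProbabilityMeasure (rewardLaw β a θ) := by
  unfold rewardLaw; infer_instance

theorem integral_rewardLaw (β : ℝ) (a θ : Vec d) (G : ℝ → ℝ) :
    ∫ r, G r ∂(rewardLaw β a θ)
      = logistic β (inner ℝ a θ) * G 1 + (1 - logistic β (inner ℝ a θ)) * G 0 := by
  rw [rewardLaw, integral_bernoulliMeasure]
  simp

/-- The law of the reward as a kernel in the pair (parameter, action). -/
def rewardKernel (β : ℝ) : Kernel (Vec d × Vec d) ℝ where
  toFun p := rewardLaw β p.2 p.1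
  measurable' := by
    classical
    refine Measure.measurable_of_measurable_coe _ fun s hs => ?_
    have hl : Measurable fun p : Vec d × Vec d => logistic β (inner ℝ p.2 p.1) :=
      (continuous_logistic β).measurable.comp (by fun_prop)
    have hq : Measurable fun p : Vec d × Vec d =>
        (⟨logistic β (inner ℝ p.2 p.1), logistic_mem_unitInterval β _⟩ : unitInterval) :=
      hl.subtype_mk
    simp only [rewardLaw, bernoulliMeasure_apply _ hs]
    split_ifs <;> fun_prop

theorem rewardKernel_apply (β : ℝ) (p : Vec d × Vec d) :
    rewardKernel β p = rewardLaw β p.2 p.1 := rfl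

instance isMarkovKernel_rewardKernel (β : ℝ) :
    IsMarkovKernel (rewardKernel (d := d) β) :=
  ⟨fun p => by rw [rewardKernel_apply]; infer_instance⟩

end

/-! ### The mutual information of parameter, reward and action -/

section

variable {d : ℕ}

/-- The probability of the reward `1` for the action `a`, when the parameter has law `ν`. -/
def logisticMean (β : ℝ) (ν : Measure (Vec d)) (a : Vec d) : ℝ :=
  ∫ θ, logistic β (inner ℝ a θ) ∂ν

/-- The joint law of `((θ, a), r)` for independent `θ` and `a` of law `ν`, when `r` is the reward
of the action `a` for the parameter `θ`. -/
def jointLaw (β : ℝ) (ν : Measure (Vec d)) : Measure ((Vec d × Vec d) × ℝ) :=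
  (ν.prod ν) ⊗ₘ rewardKernel β

variable {β : ℝ} {ν : Measure (Vec d)} [IsProbabilityMeasure ν]

instance isProbabilityMeasure_jointLaw : IsProbabilityMeasure (jointLaw β ν) := by
  unfold jointLaw; infer_instance

@[fun_prop]
theorem measurable_logistic (β : ℝ) : Measurable (logistic β) := (continuous_logistic β).measurable

theorem measurable_logistic_inner (β : ℝ) :
    Measurable fun p : Vec d × Vec d => logistic β (inner ℝ p.1 p.2) := by
  fun_prop

theorem abs_logistic_le_one (β x : ℝ) : |logistic β x| ≤ 1 := by
  rw [abs_of_nonneg (logistic_nonneg β x)]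
  exact logistic_le_one β x

theorem integrable_logistic_inner (β : ℝ) (a : Vec d) :
    Integrable (fun θ => logistic β (inner ℝ a θ)) ν :=
  integrable_of_measurable_bounded (C := 1) (by fun_prop) fun _ => abs_logistic_le_one β _

theorem logisticMean_mem_unitInterval (β : ℝ) (a : Vec d) :
    logisticMean β ν a ∈ unitInterval := by
  refine ⟨integral_nonneg fun θ => logistic_nonneg β _, ?_⟩
  refine (integral_mono (integrable_logistic_inner β a) (integrable_const 1)
    fun θ => logistic_le_one β _).trans ?_
  simp

theorem measurable_logisticMean (β : ℝ) : Measurable (logisticMean β ν) :=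
  (StronglyMeasurable.integral_prod_right' (f := fun p : Vec d × Vec d =>
    logistic β (inner ℝ p.1 p.2)) (measurable_logistic_inner β).stronglyMeasurable).measurable

theorem integral_jointLaw {G : (Vec d × Vec d) × ℝ → ℝ} (hG : Measurable G) {C : ℝ}
    (hC : ∀ p, |G p| ≤ C) :
    ∫ p, G p ∂(jointLaw β ν)
      = ∫ a, ∫ θ, (logistic β (inner ℝ a θ) * G ((θ, a), 1)
          + (1 - logistic β (inner ℝ a θ)) * G ((θ, a), 0)) ∂ν ∂ν := by
  have hGi : Integrable G ((ν.prod ν) ⊗ₘ rewardKernel β) := integrable_of_measurable_bounded hG hC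
  have hi : Integrable (fun p : Vec d × Vec d => logistic β (inner ℝ p.2 p.1) * G (p, 1)
      + (1 - logistic β (inner ℝ p.2 p.1)) * G (p, 0)) (ν.prod ν) := by
    refine integrable_of_measurable_bounded (by fun_prop) (C := C) fun p => ?_
    have h0 := logistic_nonneg β (inner ℝ p.2 p.1)
    have h1 := logistic_le_one β (inner ℝ p.2 p.1)
    have h2 := abs_le.1 (hC (p, 1))
    have h3 := abs_le.1 (hC (p, 0))
    rw [abs_le]
    constructor <;> nlinarith
  rw [jointLaw, Measure.integral_compProd hGi]
  simp only [rewardKernel_apply, integral_rewardLaw]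
  rw [integral_prod_symm _ hi]

/-- The mutual information between the parameter and the pair (reward, action) is at least twice the
mean variance of the success probability. -/
theorem two_mul_integral_variance_le_klDiv :
    ENNReal.ofReal (2 * ∫ a, ∫ θ, (logistic β (inner ℝ a θ) - logisticMean β ν a) ^ 2 ∂ν ∂ν)
      ≤ klDiv ((jointLaw β ν).map fun p => (p.1.1, p.2, p.1.2))
          (ν.prod ((jointLaw β ν).map fun p => (p.2, p.1.2))) := by
  have hmean := measurable_logisticMean (ν := ν) β
  -- the reward is clipped to `[0, 1]`, where it lives, so that the test function is bounded
  let c : ℝ → ℝ := fun r => max 0 (min 1 r)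
  have hc : Measurable c := by fun_prop
  have hc01 : ∀ r, 0 ≤ c r ∧ c r ≤ 1 := fun r => ⟨le_max_left _ _, by simp [c]⟩
  have hc0 : c 0 = 0 := by simp [c]
  have hc1 : c 1 = 1 := by simp [c]
  let D : Vec d → Vec d → ℝ := fun x a => logistic β (inner ℝ a x) - logisticMean β ν a
  have hD : ∀ x a, |D x a| ≤ 1 := by
    intro x a
    have h1 := logistic_nonneg β (inner ℝ a x)
    have h2 := logistic_le_one β (inner ℝ a x)
    have h3 := logisticMean_mem_unitInterval (ν := ν) β a
    rw [abs_le]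
    exact ⟨by linarith [h3.2], by linarith [h3.1]⟩
  let g : Vec d × ℝ × Vec d → ℝ := fun p =>
    4 * D p.1 p.2.2 * (c p.2.1 - logisticMean β ν p.2.2) - 2 * D p.1 p.2.2 ^ 2
  have hDm : Measurable fun p : Vec d × ℝ × Vec d => D p.1 p.2.2 := by
    simp only [D]
    fun_prop
  have hg : Measurable g := by
    simp only [g]
    fun_prop
  have hgC : ∀ p, |g p| ≤ 6 := by
    intro p
    have h1 := hD p.1 p.2.2
    have h2 : |c p.2.1 - logisticMean β ν p.2.2| ≤ 1 := by
      have h3 := logisticMean_mem_unitInterval (ν := ν) β p.2.2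
      have h4 := hc01 p.2.1
      rw [abs_le]
      exact ⟨by linarith [h3.2, h4.1], by linarith [h3.1, h4.2]⟩
    refine (abs_sub _ _).trans ?_
    rw [abs_mul, abs_mul, abs_mul, abs_pow]
    have h3 : |D p.1 p.2.2| ^ 2 ≤ 1 := pow_le_one₀ (abs_nonneg _) h1
    have h4 := mul_le_one₀ h1 (abs_nonneg _) h2
    rw [sq_abs] at h3
    simp only [Nat.abs_ofNat, sq_abs]
    linarith
  have hexpC : ∀ p, |Real.exp (g p)| ≤ Real.exp 6 := fun p => by
    rw [Real.abs_exp]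
    exact Real.exp_le_exp.2 ((le_abs_self _).trans (hgC p))
  have hF : Measurable fun p : (Vec d × Vec d) × ℝ => (p.1.1, p.2, p.1.2) := by fun_prop
  have hF' : Measurable fun p : (Vec d × Vec d) × ℝ => (p.2, p.1.2) := by fun_prop
  have := Measure.isProbabilityMeasure_map (μ := jointLaw β ν) hF.aemeasurable
  have := Measure.isProbabilityMeasure_map (μ := jointLaw β ν) hF'.aemeasurable
  have hexp : ∫ p, Real.exp (g p) ∂(ν.prod ((jointLaw β ν).map fun p => (p.2, p.1.2))) ≤ 1 := by
    rw [integral_prod _ (integrable_of_measurable_bounded (by fun_prop) hexpC)]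
    have hx : ∀ x, ∫ q, Real.exp (g (x, q)) ∂((jointLaw β ν).map fun p => (p.2, p.1.2)) ≤ 1 := by
      intro x
      have hgx : Measurable fun q : ℝ × Vec d => Real.exp (g (x, q)) := by fun_prop
      rw [integral_map hF'.aemeasurable hgx.aestronglyMeasurable,
        integral_jointLaw (G := fun p => Real.exp (g (x, p.2, p.1.2))) (by fun_prop)
          fun p => hexpC _]
      have ha : ∀ a, ∫ θ, (logistic β (inner ℝ a θ) * Real.exp (g (x, 1, a))
          + (1 - logistic β (inner ℝ a θ)) * Real.exp (g (x, 0, a))) ∂ν ≤ 1 := by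
        intro a
        have hi := integrable_logistic_inner (ν := ν) β a
        have hi' : Integrable (fun θ => 1 - logistic β (inner ℝ a θ)) ν :=
          (integrable_const 1).sub hi
        rw [integral_add (hi.mul_const _) (hi'.mul_const _), integral_mul_const,
          integral_mul_const, integral_sub (integrable_const 1) hi]
        have := bernoulli_exp_le_one (logisticMean_mem_unitInterval (ν := ν) β a) (D x a)
        simpa [g, hc0, hc1, logisticMean] using this
      refine (integral_mono_of_nonneg (.of_forall fun a => integral_nonneg fun θ => ?_)
        (integrable_const (1 : ℝ)) (.of_forall ha)).trans (by simp)
      have h0 := logistic_nonneg β (inner ℝ a θ)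
      have h1 := sub_nonneg.2 (logistic_le_one β (inner ℝ a θ))
      exact add_nonneg (mul_nonneg h0 (Real.exp_pos _).le) (mul_nonneg h1 (Real.exp_pos _).le)
    exact (integral_mono_of_nonneg
      (.of_forall fun x => integral_nonneg fun q => (Real.exp_pos _).le)
      (integrable_const (1 : ℝ)) (.of_forall hx)).trans (by simp)
  refine le_trans (ENNReal.ofReal_le_ofReal (le_of_eq ?_))
    (ofReal_integral_le_klDiv hg hgC hexp)
  rw [integral_map hF.aemeasurable hg.aestronglyMeasurable,
    integral_jointLaw (G := fun p => g (p.1.1, p.2, p.1.2)) (by fun_prop) fun p => hgC _,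
    ← integral_const_mul]
  congr 1
  ext a
  rw [← integral_const_mul]
  congr 1
  ext θ
  simp only [g, hc0, hc1, D]
  ring

end

/-! ### The regret for the logistic link -/

section

variable {d : ℕ} {β : ℝ} {ν : Measure (Vec d)} [IsProbabilityMeasure ν]

/-- For independent action and parameter of the same law on the unit sphere, the square of the mean
regret is at most `6 d` times the mean variance of the success probability. -/
theorem sq_regret_le (hβ : 0 < β) (hν : ∀ᵐ θ ∂ν, ‖θ‖ = 1) :
    (logistic β 1 - ∫ a, logisticMean β ν a ∂ν) ^ 2
      ≤ 6 * d * ∫ a, ∫ θ, (logistic β (inner ℝ a θ) - logisticMean β ν a) ^ 2 ∂ν ∂ν := by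
  obtain ⟨v, hv⟩ := hν.exists
  have hd : 1 ≤ d := by
    rcases Nat.eq_zero_or_pos d with rfl | h
    · rw [Subsingleton.elim v 0, norm_zero] at hv
      exact absurd hv zero_ne_one
    · exact h
  have hF := sub_pos.2 (half_lt_logistic_one hβ)
  set F := logistic β 1 - 1 / 2 with hF_def
  -- the identity, modified off the unit sphere so that all its values have norm one
  classical
  let e : Vec d → Vec d := fun θ => if ‖θ‖ = 1 then θ else v
  have he : Measurable e :=
    Measurable.ite (measurableSet_eq_fun measurable_norm measurable_const) measurable_id
      measurable_const
  have h1 : ∀ θ, ‖e θ‖ = 1 := by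
    intro θ
    simp only [e]
    split_ifs with h
    · exact h
    · exact hv
  have heq : ∀ θ, ‖θ‖ = 1 → e θ = θ := fun θ h => if_pos h
  obtain ⟨σ, hσ, hσ'⟩ := exists_measurable_rightInverse_oddLogistic hβ
  have key := sq_one_sub_integral_linkMean_le (ν := ν) hd he h1 (isOddLink_oddLogistic hβ) hσ hσ'
  have hm : ∀ a, ‖a‖ = 1 →
      linkMean ν e (oddLogistic β) a = (logisticMean β ν a - 1 / 2) / F := by
    intro a ha
    have : ∫ θ, oddLogistic β (inner ℝ (e a) (e θ)) ∂ν
        = ∫ θ, (logistic β (inner ℝ a θ) - 1 / 2) / F ∂ν := by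
      refine integral_congr_ae ?_
      filter_upwards [hν] with θ hθ
      rw [heq a ha, heq θ hθ, oddLogistic]
    rw [linkMean, this, integral_div,
      integral_sub (integrable_logistic_inner β a) (integrable_const _)]
    simp [logisticMean]
  have hV : ∀ a, ‖a‖ = 1 → linkVar ν e (oddLogistic β) a
      = (∫ θ, (logistic β (inner ℝ a θ) - logisticMean β ν a) ^ 2 ∂ν) / F ^ 2 := by
    intro a ha
    rw [linkVar, ← integral_div]
    refine integral_congr_ae ?_
    filter_upwards [hν] with θ hθ
    rw [hm a ha, heq a ha, heq θ hθ, oddLogistic, ← hF_def]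
    field_simp
    ring
  have hm' : ∫ a, linkMean ν e (oddLogistic β) a ∂ν
      = (∫ a, logisticMean β ν a ∂ν - 1 / 2) / F := by
    have hi : Integrable (logisticMean β ν) ν :=
      integrable_of_measurable_bounded (measurable_logisticMean β) (C := 1) fun a => by
        have := logisticMean_mem_unitInterval (ν := ν) β a
        rw [abs_of_nonneg this.1]
        exact this.2
    rw [integral_congr_ae (hν.mono hm), integral_div, integral_sub hi (integrable_const _)]
    simp
  rw [hm', integral_congr_ae (hν.mono hV), integral_div] at key
  have e1 : 1 - (∫ a, logisticMean β ν a ∂ν - 1 / 2) / F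
      = (logistic β 1 - ∫ a, logisticMean β ν a ∂ν) / F := by
    field_simp
    rw [hF_def]
    ring
  rw [e1, div_pow, ← mul_div_assoc] at key
  exact (div_le_div_iff_of_pos_right (by positivity)).1 key

end

/-! ### Conditional laws along a run of Thompson sampling -/

section CondDistrib

theorem map_prodMk_prodMk_eq_compProd {Ω 𝒳 𝒴 𝒲 : Type*} [MeasurableSpace Ω] [MeasurableSpace 𝒳]
    [MeasurableSpace 𝒴] [MeasurableSpace 𝒲] {μ : Measure Ω} [IsFiniteMeasure μ] {X : Ω → 𝒳}
    {Y : Ω → 𝒴} {W : Ω → 𝒲} (hX : Measurable X) (hY : Measurable Y) (hW : Measurable W)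
    {κ : Kernel 𝒳 𝒴} [IsFiniteKernel κ] {η : Kernel (𝒳 × 𝒴) 𝒲} [IsFiniteKernel η]
    (hκ : μ.map (fun ω => (X ω, Y ω)) = μ.map X ⊗ₘ κ)
    (hη : μ.map (fun ω => ((X ω, Y ω), W ω)) = μ.map (fun ω => (X ω, Y ω)) ⊗ₘ η) :
    μ.map (fun ω => (X ω, Y ω, W ω)) = μ.map X ⊗ₘ (κ ⊗ₖ η) := by
  rw [← Measure.compProd_assoc', ← hκ, ← hη, Measure.map_map (by fun_prop) (by fun_prop)]
  rfl

variable {Ω 𝒳 𝒴 : Type*} [MeasurableSpace Ω] [MeasurableSpace 𝒳]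
  [MeasurableSpace 𝒴] [StandardBorelSpace 𝒴] [Nonempty 𝒴]
  {μ : Measure Ω} [IsProbabilityMeasure μ] {X : Ω → 𝒳} {Y : Ω → 𝒴}

theorem map_prodMk_eq_compProd (hX : Measurable X) (hY : Measurable Y) {κ : Kernel 𝒳 𝒴}
    [IsFiniteKernel κ] (h : ∀ᵐ ω ∂μ, condDistrib Y X μ (X ω) = κ (X ω)) :
    μ.map (fun ω => (X ω, Y ω)) = μ.map X ⊗ₘ κ := by
  rw [← compProd_map_condDistrib hY.aemeasurable]
  ext s hs
  rw [Measure.compProd_apply hs, Measure.compProd_apply hs,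
    lintegral_map (Kernel.measurable_kernel_prodMk_left hs) hX,
    lintegral_map (Kernel.measurable_kernel_prodMk_left hs) hX]
  refine lintegral_congr_ae ?_
  filter_upwards [h] with ω hω
  rw [hω]

theorem ae_ae_condDistrib_iff (hX : Measurable X) (hY : Measurable Y) {s : Set 𝒴}
    (hs : MeasurableSet s) :
    (∀ᵐ ω ∂μ, ∀ᵐ y ∂(condDistrib Y X μ (X ω)), y ∈ s) ↔ ∀ᵐ ω ∂μ, Y ω ∈ s := by
  have h1 : MeasurableSet {x | ∀ᵐ y ∂(condDistrib Y X μ x), y ∈ s} := by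
    simp only [ae_iff]
    exact measurableSet_eq_fun (Kernel.measurable_coe _ hs.compl) measurable_const
  rw [← ae_map_iff (p := fun x => ∀ᵐ y ∂(condDistrib Y X μ x), y ∈ s) hX.aemeasurable h1,
    ← Measure.ae_compProd_iff (p := fun q : 𝒳 × 𝒴 => q.2 ∈ s) (measurable_snd hs),
    compProd_map_condDistrib hY.aemeasurable,
    ae_map_iff (hX.prodMk hY).aemeasurable (measurable_snd hs)]

end CondDistrib

variable {d : ℕ}

theorem meanReward_eq (β : ℝ) (a θ : Vec d) : meanReward β a θ = logistic β (inner ℝ a θ) := by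
  rw [meanReward, integral_rewardLaw]
  ring

theorem logistic_le_logistic_iff {β : ℝ} (hβ : 0 < β) {x y : ℝ} :
    logistic β x ≤ logistic β y ↔ x ≤ y := by
  rw [logistic_eq_sigmoid, logistic_eq_sigmoid, Real.sigmoid_le_iff, mul_le_mul_iff_right₀ hβ]

/-- The optimal action for a parameter on the unit sphere is the parameter itself. -/
theorem IsOptimalMap.eq_self {β : ℝ} (hβ : 0 < β) {𝒜 𝒪 : Set (Vec d)}
    (h𝒜 : 𝒜 ⊆ Metric.closedBall 0 1) (h𝒪 : 𝒪 ⊆ Metric.sphere 0 1) (h𝒪𝒜 : 𝒪 ⊆ 𝒜)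
    {π : Vec d → Vec d} (hπ : IsOptimalMap β 𝒜 𝒪 π) {θ : Vec d} (hθ : θ ∈ 𝒪) : π θ = θ := by
  obtain ⟨h1, h2⟩ := hπ θ hθ
  have h3 : ‖π θ‖ ≤ 1 := by simpa using h𝒜 h1
  have h4 : ‖θ‖ = 1 := by simpa using h𝒪 hθ
  have h5 : meanReward β θ θ ≤ meanReward β (π θ) θ := h2 (h𝒪𝒜 hθ)
  rw [meanReward_eq, meanReward_eq, logistic_le_logistic_iff hβ, real_inner_self_eq_norm_sq, h4]
    at h5
  have h6 : ‖π θ - θ‖ ^ 2 ≤ 0 := by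
    rw [norm_sub_sq_real, h4]
    nlinarith [norm_nonneg (π θ)]
  rw [← sub_eq_zero, ← norm_eq_zero]
  exact pow_eq_zero_iff two_ne_zero |>.1 (le_antisymm h6 (sq_nonneg _))

theorem ae_rewardLaw_mem_Icc (β : ℝ) (a θ : Vec d) :
    ∀ᵐ r ∂(rewardLaw β a θ), r ∈ Set.Icc (0 : ℝ) 1 := by
  rw [ae_iff]
  exact bernoulliMeasure_apply_of_notMem_of_notMem _ measurableSet_Icc.compl (by simp) (by simp)

section Run

variable {Ω : Type*} [MeasurableSpace Ω] {μ : Measure Ω} [IsProbabilityMeasure μ] {β : ℝ} {T : ℕ}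
  {prior : Measure (Vec d)} {π : Vec d → Vec d} {Θ : Ω → Vec d} {Θhat : ℕ → Ω → Vec d}
  {R Ropt : ℕ → Ω → ℝ} {t : ℕ}

theorem IsThompsonRun.measurable_history (hrun : IsThompsonRun β T prior π Θ Θhat R Ropt μ)
    (hπ : Measurable π) (t : ℕ) : Measurable (history π Θhat R t) :=
  measurable_pi_lambda _ fun s =>
    (hπ.comp (hrun.measurable_sample s)).prodMk (hrun.measurable_reward s)

theorem IsThompsonRun.ae_sample_mem (hrun : IsThompsonRun β T prior π Θ Θhat R Ropt μ)
    (hπ : Measurable π) (ht : t < T) {s : Set (Vec d)} (hs : MeasurableSet s)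
    (h : ∀ᵐ ω ∂μ, Θ ω ∈ s) : ∀ᵐ ω ∂μ, Θhat t ω ∈ s := by
  have hH := hrun.measurable_history hπ t
  rw [← ae_ae_condDistrib_iff hH hrun.measurable_param hs] at h
  rw [← ae_ae_condDistrib_iff (hH.prodMk hrun.measurable_param) (hrun.measurable_sample t) hs]
  filter_upwards [h, hrun.law_sample t ht] with ω h1 h2
  rwa [h2]

/-- Given the history, the parameter and the sample are independent with the posterior law. -/
theorem IsThompsonRun.map_history_param_sample
    (hrun : IsThompsonRun β T prior π Θ Θhat R Ropt μ) (hπ : Measurable π) (ht : t < T) :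
    μ.map (fun ω => (history π Θhat R t ω, Θ ω, Θhat t ω))
      = μ.map (history π Θhat R t) ⊗ₘ (condDistrib Θ (history π Θhat R t) μ ⊗ₖ
          Kernel.prodMkRight (Vec d) (condDistrib Θ (history π Θhat R t) μ)) := by
  have hH := hrun.measurable_history hπ t
  refine map_prodMk_prodMk_eq_compProd hH hrun.measurable_param (hrun.measurable_sample t)
    (compProd_map_condDistrib hrun.measurable_param.aemeasurable).symm ?_
  exact map_prodMk_eq_compProd (hH.prodMk hrun.measurable_param) (hrun.measurable_sample t)
    (hrun.law_sample t ht)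

theorem compProd_prodMkRight_apply {𝒳 𝒴 : Type*} [MeasurableSpace 𝒳] [MeasurableSpace 𝒴]
    (κ : Kernel 𝒳 𝒴) [IsMarkovKernel κ] (x : 𝒳) :
    (κ ⊗ₖ Kernel.prodMkRight 𝒴 κ) x = (κ x).prod (κ x) := by
  rw [Kernel.compProd_apply_eq_compProd_sectR]
  have : Kernel.sectR (Kernel.prodMkRight 𝒴 κ) x = Kernel.const 𝒴 (κ x) := by
    ext y
    simp
  rw [this, Measure.compProd_const]

/-- The posterior joint law of the parameter, the sample and the reward. -/
theorem IsThompsonRun.ae_condDistrib_eq_jointLaw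
    (hrun : IsThompsonRun β T prior π Θ Θhat R Ropt μ) (hπ : Measurable π) (ht : t < T)
    (hfix : ∀ᵐ ω ∂μ, π (Θhat t ω) = Θhat t ω) :
    ∀ᵐ ω ∂μ, condDistrib (fun ω' => ((Θ ω', Θhat t ω'), R t ω')) (history π Θhat R t) μ
        (history π Θhat R t ω)
      = jointLaw β (condDistrib Θ (history π Θhat R t) μ (history π Θhat R t ω)) := by
  have hH := hrun.measurable_history hπ t
  have hΘ := hrun.measurable_param
  have hS := hrun.measurable_sample t
  have hR := hrun.measurable_reward t
  have h1 : μ.map (fun ω => ((history π Θhat R t ω, Θ ω, Θhat t ω), R t ω))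
      = μ.map (fun ω => (history π Θhat R t ω, Θ ω, Θhat t ω)) ⊗ₘ
          Kernel.prodMkLeft _ (rewardKernel β) := by
    refine map_prodMk_eq_compProd (by fun_prop) hR ?_
    filter_upwards [hrun.law_reward t ht, hfix] with ω h2 h3
    rw [h2, h3]
    rfl
  have h2 := map_prodMk_prodMk_eq_compProd hH (hΘ.prodMk hS) hR
    (hrun.map_history_param_sample hπ ht) h1
  have h3 := condDistrib_ae_eq_of_measure_eq_compProd (history π Θhat R t)
    ((hΘ.prodMk hS).prodMk hR).aemeasurable h2
  filter_upwards [ae_of_ae_map hH.aemeasurable h3] with ω hω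
  rw [hω, Kernel.compProd_apply_eq_compProd_sectR, compProd_prodMkRight_apply, jointLaw]
  rfl

theorem IsThompsonRun.ae_reward_mem_Icc
    (hrun : IsThompsonRun β T prior π Θ Θhat R Ropt μ) (hπ : Measurable π) (ht : t < T) :
    ∀ᵐ ω ∂μ, R t ω ∈ Set.Icc (0 : ℝ) 1 := by
  have hH := hrun.measurable_history hπ t
  rw [← ae_ae_condDistrib_iff (hH.prodMk (hrun.measurable_param.prodMk (hrun.measurable_sample t)))
    (hrun.measurable_reward t) measurableSet_Icc]
  filter_upwards [hrun.law_reward t ht] with ω h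
  rw [h]
  exact ae_rewardLaw_mem_Icc _ _ _

theorem IsThompsonRun.ae_optReward_mem_Icc
    (hrun : IsThompsonRun β T prior π Θ Θhat R Ropt μ) (hπ : Measurable π) (ht : t < T) :
    ∀ᵐ ω ∂μ, Ropt t ω ∈ Set.Icc (0 : ℝ) 1 := by
  have hH := hrun.measurable_history hπ t
  rw [← ae_ae_condDistrib_iff (hH.prodMk hrun.measurable_param)
    (hrun.measurable_optReward t) measurableSet_Icc]
  filter_upwards [hrun.law_optReward t ht] with ω h
  rw [h]
  exact ae_rewardLaw_mem_Icc _ _ _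

theorem IsThompsonRun.integrable_reward
    (hrun : IsThompsonRun β T prior π Θ Θhat R Ropt μ) (hπ : Measurable π) (ht : t < T) :
    Integrable (R t) μ :=
  Integrable.of_mem_Icc 0 1 (hrun.measurable_reward t).aemeasurable (hrun.ae_reward_mem_Icc hπ ht)

theorem IsThompsonRun.integrable_optReward
    (hrun : IsThompsonRun β T prior π Θ Θhat R Ropt μ) (hπ : Measurable π) (ht : t < T) :
    Integrable (Ropt t) μ :=
  Integrable.of_mem_Icc 0 1 (hrun.measurable_optReward t).aemeasurable
    (hrun.ae_optReward_mem_Icc hπ ht)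

/-- The expected regret given the history, as a function of the posterior law. -/
theorem IsThompsonRun.condRegret_ae_eq
    (hrun : IsThompsonRun β T prior π Θ Θhat R Ropt μ) (hπ : Measurable π) (ht : t < T)
    (hfix : ∀ᵐ ω ∂μ, π (Θ ω) = Θ ω ∧ ‖Θ ω‖ = 1) (hfix' : ∀ᵐ ω ∂μ, π (Θhat t ω) = Θhat t ω) :
    ∀ᵐ ω ∂μ, condRegret π Θhat R Ropt μ t ω = logistic β 1
      - ∫ a, logisticMean β (condDistrib Θ (history π Θhat R t) μ (history π Θhat R t ω)) a
          ∂(condDistrib Θ (history π Θhat R t) μ (history π Θhat R t ω)) := by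
  have hH := hrun.measurable_history hπ t
  have hΘ := hrun.measurable_param
  have hS := hrun.measurable_sample t
  have hRi := hrun.integrable_reward hπ ht
  have hOi := hrun.integrable_optReward hπ ht
  set H := history π Θhat R t with hH_def
  have hle1 : MeasurableSpace.comap H inferInstance
      ≤ MeasurableSpace.comap (fun ω => (H ω, Θ ω)) inferInstance := by
    rw [show H = Prod.fst ∘ fun ω => (H ω, Θ ω) from rfl, ← MeasurableSpace.comap_comp]
    exact MeasurableSpace.comap_mono measurable_fst.comap_le
  have hle2 : MeasurableSpace.comap H inferInstance
      ≤ MeasurableSpace.comap (fun ω => (H ω, Θ ω, Θhat t ω)) inferInstance := by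
    rw [show H = Prod.fst ∘ fun ω => (H ω, Θ ω, Θhat t ω) from rfl, ← MeasurableSpace.comap_comp]
    exact MeasurableSpace.comap_mono measurable_fst.comap_le
  have hO : μ[Ropt t | MeasurableSpace.comap H inferInstance] =ᵐ[μ] fun _ => logistic β 1 := by
    have h1 : μ[Ropt t | MeasurableSpace.comap (fun ω => (H ω, Θ ω)) inferInstance]
        =ᵐ[μ] fun _ => logistic β 1 := by
      filter_upwards [condExp_ae_eq_integral_condDistrib' (hH.prodMk hΘ) hOi,
        hrun.law_optReward t ht, hfix] with ω h2 h3 h4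
      rw [h2, h3, h4.1, ← meanReward, meanReward_eq, real_inner_self_eq_norm_sq, h4.2, one_pow]
    have h2 := condExp_congr_ae (m := MeasurableSpace.comap H inferInstance) h1
    rw [condExp_const hH.comap_le] at h2
    exact (condExp_condExp_of_le hle1 (hH.prodMk hΘ).comap_le).symm.trans h2
  have hR : μ[R t | MeasurableSpace.comap H inferInstance]
      =ᵐ[μ] fun ω => ∫ a, logisticMean β (condDistrib Θ H μ (H ω)) a ∂(condDistrib Θ H μ (H ω)) := by
    have h1 : μ[R t | MeasurableSpace.comap (fun ω => (H ω, Θ ω, Θhat t ω)) inferInstance]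
        =ᵐ[μ] fun ω => logistic β (inner ℝ (Θhat t ω) (Θ ω)) := by
      filter_upwards [condExp_ae_eq_integral_condDistrib' (hH.prodMk (hΘ.prodMk hS)) hRi,
        hrun.law_reward t ht, hfix'] with ω h2 h3 h4
      rw [h2, h3, h4, ← meanReward, meanReward_eq]
    have h2 := condExp_congr_ae (m := MeasurableSpace.comap H inferInstance) h1
    have h3 := (condExp_condExp_of_le (f := R t) hle2
      (hH.prodMk (hΘ.prodMk hS)).comap_le).symm.trans h2
    have hm : Measurable fun p : Vec d × Vec d => logistic β (inner ℝ p.2 p.1) := by fun_prop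
    have h4 := condExp_ae_eq_integral_condDistrib (μ := μ) hH (hΘ.prodMk hS).aemeasurable
      hm.stronglyMeasurable (integrable_of_measurable_bounded (by fun_prop)
        fun ω => abs_logistic_le_one β _)
    have h5 := condDistrib_ae_eq_of_measure_eq_compProd H (hΘ.prodMk hS).aemeasurable
      (hrun.map_history_param_sample hπ ht)
    filter_upwards [h3, h4, ae_of_ae_map hH.aemeasurable h5] with ω h6 h7 h8
    rw [h6, h7, h8, compProd_prodMkRight_apply, integral_prod_symm]
    · rfl
    · exact integrable_of_measurable_bounded hm fun _ => abs_logistic_le_one β _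
  filter_upwards [condExp_sub hOi hRi (MeasurableSpace.comap H inferInstance), hO, hR]
    with ω h1 h2 h3
  rw [condRegret]
  refine h1.trans ?_
  rw [Pi.sub_apply, h2, h3]

/-- The mutual information is at least twice the posterior mean variance of the success probability;
`ν` only abbreviates the posterior law. -/
theorem IsThompsonRun.two_mul_integral_variance_le_mutualInfo
    (hrun : IsThompsonRun β T prior π Θ Θhat R Ropt μ) (hπ : Measurable π) (ht : t < T)
    (hfix : ∀ᵐ ω ∂μ, π (Θ ω) = Θ ω) (hfix' : ∀ᵐ ω ∂μ, π (Θhat t ω) = Θhat t ω) :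
    ∀ᵐ ω ∂μ, ∀ ν, ν = condDistrib Θ (history π Θhat R t) μ (history π Θhat R t ω) →
      ENNReal.ofReal (2 * ∫ a, ∫ θ, (logistic β (inner ℝ a θ) - logisticMean β ν a) ^ 2 ∂ν ∂ν)
      ≤ disintegratedMutualInfo (fun ω' => π (Θ ω')) (fun ω' => (R t ω', π (Θhat t ω')))
          (history π Θhat R t) μ ω := by
  have hH := hrun.measurable_history hπ t
  have hΘ := hrun.measurable_param
  have hS := hrun.measurable_sample t
  have hR := hrun.measurable_reward t
  set H := history π Θhat R t with hH_def
  have hY : AEMeasurable (fun ω => ((Θ ω, Θhat t ω), R t ω)) μ :=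
    ((hΘ.prodMk hS).prodMk hR).aemeasurable
  have hF : Measurable fun p : (Vec d × Vec d) × ℝ => (p.1.1, p.2, p.1.2) := by fun_prop
  have hF' : Measurable fun p : (Vec d × Vec d) × ℝ => (p.2, p.1.2) := by fun_prop
  have e1 : condDistrib (fun ω => (π (Θ ω), R t ω, π (Θhat t ω))) H μ
      = condDistrib (fun ω => (Θ ω, R t ω, Θhat t ω)) H μ := by
    refine condDistrib_congr_left ?_
    filter_upwards [hfix, hfix'] with ω h1 h2
    rw [h1, h2]
  have e2 : condDistrib (fun ω => π (Θ ω)) H μ = condDistrib Θ H μ :=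
    condDistrib_congr_left hfix
  have e3 : condDistrib (fun ω => (R t ω, π (Θhat t ω))) H μ
      = condDistrib (fun ω => (R t ω, Θhat t ω)) H μ := by
    refine condDistrib_congr_left ?_
    filter_upwards [hfix'] with ω h2
    rw [h2]
  have c1 := ae_of_ae_map hH.aemeasurable (condDistrib_comp H hY hF)
  have c2 := ae_of_ae_map hH.aemeasurable (condDistrib_comp H hY hF')
  filter_upwards [c1, c2, hrun.ae_condDistrib_eq_jointLaw hπ ht hfix'] with ω h1 h2 h3 ν hν
  rw [Kernel.map_apply _ hF, h3] at h1
  rw [Kernel.map_apply _ hF', h3] at h2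
  rw [disintegratedMutualInfo, e1, e2, e3]
  have : IsProbabilityMeasure ν := by rw [hν]; infer_instance
  have key := two_mul_integral_variance_le_klDiv (β := β) (ν := ν)
  rw [← hν] at h1 h2
  simp only [Function.comp_def] at h1 h2
  rw [h1, h2, ← hν]
  exact key

end Run

end LogisticBandit

end

theorem proposition1 {d : ℕ} {Ω : Type*} [MeasurableSpace Ω]
    (μ : MeasureTheory.Measure Ω) [MeasureTheory.IsProbabilityMeasure μ]
    (β : ℝ) (hβ : 0 < β) (T : ℕ)
    (𝒜 𝒪 : Set (LogisticBandit.Vec d))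
    (h𝒜 : 𝒜 ⊆ Metric.closedBall 0 1) (h𝒪 : 𝒪 ⊆ Metric.sphere 0 1) (h𝒪𝒜 : 𝒪 ⊆ 𝒜)
    (π : LogisticBandit.Vec d → LogisticBandit.Vec d) (hπ_meas : Measurable π)
    (hπ : LogisticBandit.IsOptimalMap β 𝒜 𝒪 π)
    (prior : MeasureTheory.Measure (LogisticBandit.Vec d)) (hprior : ∀ᵐ θ ∂prior, θ ∈ 𝒪)
    (Θ : Ω → LogisticBandit.Vec d) (Θhat : ℕ → Ω → LogisticBandit.Vec d) (R Ropt : ℕ → Ω → ℝ)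
    (hrun : LogisticBandit.IsThompsonRun β T prior π Θ Θhat R Ropt μ) :
    ∀ t < T, ∀ᵐ ω ∂μ,
      LogisticBandit.infoRatio π Θ Θhat R Ropt μ t ω ≤ 9 / 2 * (d : ℝ≥0∞) := by
  intro t ht
  have hmem : ∀ᵐ ω ∂μ, Θ ω ∈ 𝒪 := by
    rw [← hrun.law_param] at hprior
    exact MeasureTheory.ae_of_ae_map hrun.measurable_param.aemeasurable hprior
  -- `𝒪` need not be measurable; this set contains it and is
  let G : Set (LogisticBandit.Vec d) := {θ | π θ = θ ∧ ‖θ‖ = 1}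
  have hG : MeasurableSet G :=
    (measurableSet_eq_fun hπ_meas measurable_id).inter
      (measurableSet_eq_fun measurable_norm measurable_const)
  have hΘG : ∀ᵐ ω ∂μ, Θ ω ∈ G := hmem.mono fun ω hω =>
    ⟨hπ.eq_self hβ h𝒜 h𝒪 h𝒪𝒜 hω, by simpa using h𝒪 hω⟩
  have hSG := hrun.ae_sample_mem hπ_meas ht hG hΘG
  have hH := hrun.measurable_history hπ_meas t
  have hpost := (LogisticBandit.ae_ae_condDistrib_iff hH hrun.measurable_param hG).2 hΘG
  have hreg := hrun.condRegret_ae_eq hπ_meas ht hΘG (hSG.mono fun _ h => h.1)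
  have hinf := hrun.two_mul_integral_variance_le_mutualInfo hπ_meas ht (hΘG.mono fun _ h => h.1)
    (hSG.mono fun _ h => h.1)
  filter_upwards [hpost, hreg, hinf] with ω h1 h2 h3
  have h4 := LogisticBandit.sq_regret_le hβ (h1.mono fun _ h => h.2)
  rw [← h2] at h4
  -- it remains that `regret² ≤ 6 d V = 3 d (2 V) ≤ (9 / 2) d (2 V)`; the form without a quotient
  -- also covers the case of vanishing information
  refine ENNReal.div_le_of_le_mul ?_
  refine le_trans ?_ (mul_le_mul_right (h3 _ rfl) _)
  rw [show (9 / 2 * (d : ℝ≥0∞)) = ENNReal.ofReal (9 / 2 * d) by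
    rw [ENNReal.ofReal_mul (by norm_num), ENNReal.ofReal_div_of_pos (by norm_num)]
    simp, ← ENNReal.ofReal_mul (by positivity)]
  refine ENNReal.ofReal_le_ofReal (h4.trans ?_)
  have hV0 : ∀ ν : MeasureTheory.Measure (LogisticBandit.Vec d),
      0 ≤ ∫ a, ∫ θ, (LogisticBandit.logistic β (inner ℝ a θ)
        - LogisticBandit.logisticMean β ν a) ^ 2 ∂ν ∂ν := fun ν =>
    MeasureTheory.integral_nonneg fun a => MeasureTheory.integral_nonneg fun θ => sq_nonneg _
  have hd : (0 : ℝ) ≤ d := by positivity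
  nlinarith [mul_nonneg hd (hV0 (condDistrib Θ (LogisticBandit.history π Θhat R t) μ
    (LogisticBandit.history π Θhat R t ω)))]
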